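/- Consider the following algorithm for IID Top-$1$-of-$2$. Let $m\ge 1$ and $0=c_0<c_1<\dots<c_m$ be real constants. Let $X_1,\dots,X_n$ ($n\ge c_m$) be IID non-negative random variables with a continuous distribution, let $Z=\max_i X_i$, and let $t_1,\dots,t_n$ be arrival times, independent of each other and of the $X_i$ and uniform on $[0,1]$; the pairs $(t_i,X_i)$ are presented in increasing order of $t_i$. Choose thresholds $\tau_1>\dots>\tau_m$ with $\sum_{j=1}^n \Pr[X_j\ge\tau_i]=c_i$ for $1\le i\le m$, and put $\tau(t)=\tau_{\lceil tm\rceil}$. The algorithm accepts the first presented value $X_i$ with $X_i>\tau(t_i)$, and afterwards the next presented value (if any) that exceeds $X_i$. Its reward $\mathsf{ALG}$ is the largest accepted value ($0$ if nothing is accepted). For $1\le j\le m$ and $\ell\in[c_{j-1},c_j]$ let $$f_j(\ell)=1-e^{-\frac1m\sum_{r=1}^{j-1}c_r}+\sum_{k=j}^m e^{-\frac1m\sum_{r=1}^{k-1}c_r}\cdot\frac{e^{-\frac{(m+1)c_k}{m}}\Big(m e^{c_k}\ell\,(e^{c_k/m}-1)(2c_k-\ell)+c_k\,\ell\, e^{k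 c_k/m}(\ell-c_k)\Big)}{m c_k^2}$$ and $$\rho(c_1,\dots,c_m)=\min\Big\{1-e^{-\frac1m\sum_{i=1}^m c_i},\ \min_{1\le j\le m}\ \inf_{\ell\in[c_{j-1},c_j],\,\ell>0}\frac{f_j(\ell)}{1-e^{-\ell}}\Big\}.$$ Then, as $n\to\infty$, the competitive ratio of the algorithm is at least $\rho(c_1,\dots,c_m)$: for every $\varepsilon>0$ there is an $N$, depending only on $m$, $c_1,\dots,c_m$ and $\varepsilon$, such that $\mathbb E[\mathsf{ALG}]\ge(\rho(c_1,\dots,c_m)-\varepsilon)\,\mathbb E[Z]$ for every $n\ge N$, every such distribution and every such choice of thresholds. Moreover, for $m=10$ and $$(c_1,\dots,c_{10})=(0.35598315,\ 0.56202538,\ 0.86407969,\ 1.22558122,\ 1.65459166,\ 2.14361195,\ 2.5868228,\ 3.07922161,\ 4.0722262,\ 5.21637928)$$ one has $\rho(c_1,\dots,c_{10})\ge 0.883$, and with these parameters $\mathbb E[\mathsf{ALG}]\ge 0.883\,\mathbb E[Z]$ for all sufficiently large $n$ (uniformly over the distribution). -/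

import Mathlib

open MeasureTheory

noncomputable section

namespace TopOneOfTwo

/-- The time-dependent threshold `τ(t) = τ_⌈t m⌉`. -/
def stepThreshold (m : ℕ) (τ : ℕ → ℝ) (t : ℝ) : ℝ := τ ⌈t * m⌉₊

/-- The values accepted by the algorithm on a sequence of pairs (arrival time, value), listed in
order of arrival: the first value exceeding the threshold in force at its arrival is accepted, and
after it the next value (if any) exceeding the accepted one. -/
def accepted (θ : ℝ → ℝ) : List (ℝ × ℝ) → List ℝ
  | [] => []
  | p :: L =>
    if θ p.1 < p.2 then p.2 :: ((L.map Prod.snd).find? (fun v => decide (p.2 < v))).toList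
    else accepted θ L

/-- The pairs (arrival time, value), sorted by arrival time. -/
def arrivals {n : ℕ} (ω : Fin n → ℝ × ℝ) : List (ℝ × ℝ) :=
  List.ofFn fun i => ω (Tuple.sort (fun k => (ω k).1) i)

/-- The reward: the largest accepted value, and `0` if nothing is accepted. -/
def reward {n : ℕ} (θ : ℝ → ℝ) (ω : Fin n → ℝ × ℝ) : ℝ :=
  (accepted θ (arrivals ω)).foldr max 0

/-- The prophet's value `Z = max_i X_i`. -/
def prophet {n : ℕ} (ω : Fin n → ℝ × ℝ) : ℝ := ⨆ i, (ω i).2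

/-- The joint law of `n` independent pairs (arrival time, value): the arrival time is uniform on
`[0, 1]` and independent of the value, which has law `μ`. -/
def instanceLaw (μ : Measure ℝ) (n : ℕ) : Measure (Fin n → ℝ × ℝ) :=
  Measure.pi fun _ => (volume.restrict (Set.Icc (0 : ℝ) 1)).prod μ

/-- On every instance of `n` IID non-negative continuous values, the algorithm whose thresholds
`τ_1, …, τ_m` satisfy `∑_j P(X_j ≥ τ_i) = c_i` obtains at least `α` times the expected value of the
prophet. Expectations are taken in `[0, ∞]`. -/
def IsCompetitive (m : ℕ) (c : ℕ → ℝ) (n : ℕ) (α : ℝ) : Prop :=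
  ∀ (μ : Measure ℝ) [IsProbabilityMeasure μ], (∀ x, μ {x} = 0) → μ (Set.Iio 0) = 0 →
    ∀ τ : ℕ → ℝ,
      (∀ i, 1 ≤ i → i ≤ m → ∑ _j : Fin n, μ.real (Set.Ici (τ i)) = c i) →
      ENNReal.ofReal α * ∫⁻ ω, ENNReal.ofReal (prophet ω) ∂(instanceLaw μ n) ≤
        ∫⁻ ω, ENNReal.ofReal (reward (stepThreshold m τ) ω) ∂(instanceLaw μ n)

/-- The function `f_j(c_1, …, c_m, ℓ)`. -/
def f (m : ℕ) (c : ℕ → ℝ) (j : ℕ) (l : ℝ) : ℝ :=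
  1 - Real.exp (-(1 / (m : ℝ) * ∑ r ∈ Finset.Ico 1 j, c r)) +
    ∑ k ∈ Finset.Icc j m,
      Real.exp (-(1 / (m : ℝ) * ∑ r ∈ Finset.Ico 1 k, c r)) *
        (Real.exp (-(((m : ℝ) + 1) * c k / m)) *
            ((m : ℝ) * Real.exp (c k) * l * (Real.exp (c k / m) - 1) * (2 * c k - l) +
              c k * l * Real.exp ((k : ℝ) * c k / m) * (l - c k)) /
          ((m : ℝ) * c k ^ 2))

/-- The lower bound on the competitive ratio,
`min {1 - exp(-(c_1 + ⋯ + c_m)/m), min_j inf_{ℓ ∈ [c_{j-1}, c_j]} f_j(ℓ) / (1 - e^{-ℓ})}`;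
the point `ℓ = 0`, where the quotient is `0 / 0`, is left out. The index `j : Fin m` stands for
`j + 1` in `{1, …, m}`. -/
def ratioBound (m : ℕ) (c : ℕ → ℝ) : ℝ :=
  min (1 - Real.exp (-(1 / (m : ℝ) * ∑ i ∈ Finset.Icc 1 m, c i)))
    (⨅ j : Fin m, sInf ((fun l => f m c (j + 1) l / (1 - Real.exp (-l))) ''
      {l | l ∈ Set.Icc (c j) (c (j + 1)) ∧ 0 < l}))

/-- The ten listed parameters, preceded by `c_0 = 0`. -/
def tenParameters : ℕ → ℝ
  | 0 => 0
  | 1 => 0.35598315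
  | 2 => 0.56202538
  | 3 => 0.86407969
  | 4 => 1.22558122
  | 5 => 1.65459166
  | 6 => 2.14361195
  | 7 => 2.5868228
  | 8 => 3.07922161
  | 9 => 4.0722262
  | _ => 5.21637928

end TopOneOfTwo

end

open MeasureTheory

noncomputable section

namespace TopOneOfTwo

/-! ### The reward on a deterministic instance -/

/-! By the layer-cake formula it suffices to compare tails: `P(ALG > v) ≥ (ρ - ε) P(Z > v)` for each
`v > 0`, uniformly in the distribution (`lintegral_prophet_le_of_tail`). Write `N` for the number of
items, `q = P(X > v)`, `l = N q`, and let `j` be the first index with `τ j ≤ v`, or `m + 1` if there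
is none. For `j ≤ m`, monotonicity of the tail puts `l` in `[c (j - 1), c j]`.

Three kinds of disjoint events force a reward above `v`. Something is accepted in the first `j - 1`
slots, where every threshold exceeds `v`. Or the first acceptance, in a slot `k ≥ j`, already has a
value above `v` (`goodFirst`). Or that first value lies in `(τ k, v]`, but the next later item above
`τ k` has a value above `v`, and so is the second acceptance (`goodSecond`). The last event asks for
more than the algorithm needs, since values between `τ k` and the accepted one do no harm; in return
its probability depends on the distribution only through `q` and `P(X > τ k) = c k / N`.
Conditioning on the one or two distinguished items leaves independent identically distributed items
that must avoid a set whose mass is affine in the arrival times, so all probabilities are explicit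
integrals of powers. Their sum is `reward_tail_lower_bound`, or `finiteF` after rescaling.

As `N → ∞`, `finiteF` tends to `f`, while `P(Z > v) = 1 - (1 - l / N) ^ N` tends to `1 - e^{-l}`.
Both sides may vanish as `l → 0`, so the errors have to be `o(1) * l`, not merely `o(1)`. This works
because the only term of `f` without a factor `l` satisfies `1 - (1 - a / N) ^ N ≥ 1 - e^{-a}`
exactly (`eventually_f_sub_le_finiteF`, `exp_neg_sub_pow_le`). For `j = m + 1` the first event alone
gives the other entry of the minimum defining `ρ`.

For the ten parameters, each `f 10 c j` is a quadratic in `l` whose coefficients are bounded by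
certified values of `exp`. Comparison with `0.8831 (1 - e^{-l})` reduces to the discriminant of a
quadratic by expanding `e^{-l}` near a critical point of the difference. The excess of `0.8831` over
`0.883` absorbs `ε`. -/

theorem accepted_append_cons (θ : ℝ → ℝ) (L₁ L₂ : List (ℝ × ℝ)) (p : ℝ × ℝ)
    (h₁ : ∀ x ∈ L₁, ¬ θ x.1 < x.2) (hp : θ p.1 < p.2) :
    accepted θ (L₁ ++ p :: L₂) =
      p.2 :: ((L₂.map Prod.snd).find? (fun v => decide (p.2 < v))).toList := by
  induction L₁ with
  | nil => simp [accepted, hp]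
  | cons a L ih =>
    have ha : ¬ θ a.1 < a.2 := h₁ a (by simp)
    simp only [List.cons_append, accepted, if_neg ha]
    exact ih fun x hx => h₁ x (by simp [hx])

theorem find?_append_cons (L₁ L₂ : List (ℝ × ℝ)) (p : ℝ × ℝ) (y : ℝ)
    (h₁ : ∀ x ∈ L₁, x.2 ≤ y) (hp : y < p.2) :
    ((L₁ ++ p :: L₂).map Prod.snd).find? (fun v => decide (y < v)) = some p.2 := by
  induction L₁ with
  | nil => simp [hp]
  | cons a L ih =>
    have ha : ¬ y < a.2 := not_lt.2 (h₁ a (by simp))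
    simp only [List.cons_append, List.map_cons, List.find?_cons, ha, decide_false]
    exact ih fun x hx => h₁ x (by simp [hx])

theorem ofFn_split {α : Type*} {n : ℕ} (g : Fin n → α) (a : Fin n) :
    ∃ L₁ L₂ : List α, List.ofFn g = L₁ ++ g a :: L₂ ∧ (∀ x ∈ L₁, ∃ b < a, x = g b) := by
  refine ⟨(List.ofFn g).take a, (List.ofFn g).drop (a + 1), ?_, ?_⟩
  · have h := List.take_append_drop (a : ℕ) (List.ofFn g)
    rw [List.drop_eq_getElem_cons (by simp)] at h
    simpa using h.symm
  · intro x hx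
    obtain ⟨i, hi, rfl⟩ := List.mem_take_iff_getElem.1 hx
    have hi' : i < a := by simpa using hi
    exact ⟨⟨i, by omega⟩, Fin.lt_def.2 hi', by simp⟩

theorem ofFn_split_two {α : Type*} {n : ℕ} (g : Fin n → α) (a b : Fin n) (hab : a < b) :
    ∃ L₁ L₂ L₃ : List α, List.ofFn g = L₁ ++ g a :: (L₂ ++ g b :: L₃) ∧
      (∀ x ∈ L₁, ∃ d < a, x = g d) ∧ (∀ x ∈ L₂, ∃ d, a < d ∧ d < b ∧ x = g d) := by
  have hb : (b : ℕ) = a + 1 + (b - (a + 1)) := by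
    have := Fin.lt_def.1 hab
    omega
  refine ⟨(List.ofFn g).take a, ((List.ofFn g).drop (a + 1)).take (b - (a + 1)),
    (List.ofFn g).drop (b + 1), ?_, ?_, ?_⟩
  · have h := List.take_append_drop (a : ℕ) (List.ofFn g)
    rw [List.drop_eq_getElem_cons (by simp)] at h
    have h2 := List.take_append_drop (b - (a + 1) : ℕ) ((List.ofFn g).drop (a + 1))
    rw [List.drop_drop, ← hb, List.drop_eq_getElem_cons (i := b) (by simp)] at h2
    rw [← h2] at h
    simpa using h.symm
  · intro x hx
    obtain ⟨i, hi, rfl⟩ := List.mem_take_iff_getElem.1 hx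
    have hi' : i < a := by simpa using hi
    exact ⟨⟨i, by omega⟩, Fin.lt_def.2 hi', by simp⟩
  · intro x hx
    obtain ⟨i, hi, rfl⟩ := List.mem_take_iff_getElem.1 hx
    simp at hi
    refine ⟨⟨a + 1 + i, by omega⟩, Fin.lt_def.2 ?_, Fin.lt_def.2 ?_, by simp⟩
    · simp; omega
    · simp; omega

/-- The arrival order of an instance. -/
def order {n : ℕ} (ω : Fin n → ℝ × ℝ) : Equiv.Perm (Fin n) := Tuple.sort fun k => (ω k).1

theorem order_time_le {n : ℕ} (ω : Fin n → ℝ × ℝ) {a b : Fin n} (h : a ≤ b) :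
    (ω (order ω a)).1 ≤ (ω (order ω b)).1 :=
  Tuple.monotone_sort (fun k => (ω k).1) h

theorem order_lt_of_time_lt {n : ℕ} (ω : Fin n → ℝ × ℝ) {i k : Fin n}
    (h : (ω i).1 < (ω k).1) : (order ω).symm i < (order ω).symm k := by
  by_contra hle
  have := order_time_le ω (not_lt.1 hle)
  simp at this
  linarith

/-- If `a` is the first position whose value exceeds the threshold, the reward is at least
that value. -/
theorem le_reward_of_first_position {n : ℕ} (θ : ℝ → ℝ) (ω : Fin n → ℝ × ℝ) (a : Fin n)
    (ha : θ (ω (order ω a)).1 < (ω (order ω a)).2)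
    (hb : ∀ b < a, ¬ θ (ω (order ω b)).1 < (ω (order ω b)).2) :
    (ω (order ω a)).2 ≤ reward θ ω := by
  obtain ⟨L₁, L₂, hL, h₁⟩ := ofFn_split (fun i => ω (order ω i)) a
  have : arrivals ω = L₁ ++ ω (order ω a) :: L₂ := hL
  rw [reward, this, accepted_append_cons θ L₁ L₂ _ ?_ ha]
  · simp
  · intro x hx
    obtain ⟨b, hba, rfl⟩ := h₁ x hx
    exact hb b hba

/-- If `i` exceeds its threshold and no other item arriving no later does, the reward is at least
the value of `i`. -/
theorem le_reward_of_first {n : ℕ} (θ : ℝ → ℝ) (ω : Fin n → ℝ × ℝ) (i : Fin n)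
    (hi : θ (ω i).1 < (ω i).2)
    (hr : ∀ r, r ≠ i → ¬ ((ω r).1 ≤ (ω i).1 ∧ θ (ω r).1 < (ω r).2)) :
    (ω i).2 ≤ reward θ ω := by
  have := le_reward_of_first_position θ ω ((order ω).symm i) (by simpa using hi) ?_
  · simpa using this
  · intro b hb hlt
    refine hr (order ω b) ?_ ⟨?_, hlt⟩
    · rintro rfl
      simp at hb
    · simpa using order_time_le ω hb.le

/-- If some item arriving by time `s` exceeds its threshold, and all such items have values above
`v`, then the reward is above `v`. -/
theorem lt_reward_of_exists_early {n : ℕ} (θ : ℝ → ℝ) (ω : Fin n → ℝ × ℝ) (s v : ℝ)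
    (hex : ∃ i, (ω i).1 ≤ s ∧ θ (ω i).1 < (ω i).2)
    (hall : ∀ i, (ω i).1 ≤ s → θ (ω i).1 < (ω i).2 → v < (ω i).2) :
    v < reward θ ω := by
  classical
  obtain ⟨i, his, hi⟩ := hex
  let T : Finset (Fin n) :=
    Finset.univ.filter fun a => θ (ω (order ω a)).1 < (ω (order ω a)).2
  have hT : (order ω).symm i ∈ T := by simpa [T] using hi
  have hmin := T.min'_mem ⟨_, hT⟩
  set a := T.min' ⟨_, hT⟩ with ha
  have haT : θ (ω (order ω a)).1 < (ω (order ω a)).2 := by simpa [T] using hmin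
  have hle : a ≤ (order ω).symm i := T.min'_le _ hT
  have htime : (ω (order ω a)).1 ≤ s := by
    have := order_time_le ω hle
    simp at this
    linarith
  refine (hall _ htime haT).trans_le (le_reward_of_first_position θ ω a haT ?_)
  intro b hb hlt
  exact absurd (T.min'_le b (by simpa [T] using hlt)) (not_le.2 (ha ▸ hb))

/-- If `i` is the first item above its threshold, `k` arrives later with a value larger than that
of `i`, and no item arriving in between has such a value, then the reward is at least the value
of `k`. -/
theorem le_reward_of_second {n : ℕ} (θ : ℝ → ℝ) (ω : Fin n → ℝ × ℝ) (i k : Fin n)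
    (hi : θ (ω i).1 < (ω i).2)
    (hr : ∀ r, r ≠ i → ¬ ((ω r).1 ≤ (ω i).1 ∧ θ (ω r).1 < (ω r).2))
    (hik : (ω i).1 < (ω k).1) (hval : (ω i).2 < (ω k).2)
    (hbet : ∀ r, r ≠ i → r ≠ k → (ω i).1 ≤ (ω r).1 → (ω r).1 ≤ (ω k).1 → (ω r).2 ≤ (ω i).2) :
    (ω k).2 ≤ reward θ ω := by
  obtain ⟨L₁, L₂, L₃, hL, h₁, h₂⟩ := ofFn_split_two (fun i => ω (order ω i))
    ((order ω).symm i) ((order ω).symm k) (order_lt_of_time_lt ω hik)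
  have hA : arrivals ω = L₁ ++ ω i :: (L₂ ++ ω k :: L₃) := by
    simpa [arrivals, order] using hL
  rw [reward, hA, accepted_append_cons θ L₁ _ _ ?_ hi, find?_append_cons L₂ L₃ _ _ ?_ hval]
  · simp
  · intro x hx
    obtain ⟨d, hd₁, hd₂, rfl⟩ := h₂ x hx
    refine hbet _ ?_ ?_ ?_ ?_
    · rintro rfl; simp at hd₁
    · rintro rfl; simp at hd₂
    · simpa using order_time_le ω hd₁.le
    · simpa using order_time_le ω hd₂.le
  · intro x hx
    obtain ⟨b, hb, rfl⟩ := h₁ x hx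
    intro hlt
    refine hr (order ω b) ?_ ⟨?_, hlt⟩
    · rintro rfl; simp at hb
    · simpa using order_time_le ω hb.le

/-! ### Measurability of the reward -/

theorem measurable_stepThreshold (m : ℕ) (τ : ℕ → ℝ) : Measurable (stepThreshold m τ) :=
  (measurable_from_nat (f := τ)).comp (Nat.measurable_ceil.comp (measurable_id.mul_const _))

theorem measurable_find?_ofFn {Ω : Type*} [MeasurableSpace Ω] :
    ∀ {n : ℕ} (g : Fin n → Ω → ℝ × ℝ), (∀ i, Measurable (g i)) → ∀ (y : Ω → ℝ), Measurable y →
      Measurable fun ω => (((List.ofFn fun i => g i ω).map Prod.snd).find?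
        (fun v => decide (y ω < v))).toList.foldr max 0
  | 0, g, hg, y, hy => by simp
  | n + 1, g, hg, y, hy => by
    have ih := measurable_find?_ofFn (fun i => g i.succ) (fun i => hg _) y hy
    have hm : MeasurableSet {ω | y ω < (g 0 ω).2} := measurableSet_lt hy (hg 0).snd
    have : (fun ω => (((List.ofFn fun i => g i ω).map Prod.snd).find?
        (fun v => decide (y ω < v))).toList.foldr max 0) = fun ω =>
        if y ω < (g 0 ω).2 then max (g 0 ω).2 0 else
          (((List.ofFn fun i : Fin n => g i.succ ω).map Prod.snd).find?
            (fun v => decide (y ω < v))).toList.foldr max 0 := by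
      funext ω
      rw [List.ofFn_succ, List.map_cons, List.find?_cons]
      by_cases h : y ω < (g 0 ω).2 <;> simp [h]
    rw [this]
    exact Measurable.ite hm ((hg 0).snd.max measurable_const) ih

theorem measurable_accepted_ofFn {Ω : Type*} [MeasurableSpace Ω] {θ : ℝ → ℝ}
    (hθ : Measurable θ) :
    ∀ {n : ℕ} (g : Fin n → Ω → ℝ × ℝ), (∀ i, Measurable (g i)) →
      Measurable fun ω => (accepted θ (List.ofFn fun i => g i ω)).foldr max 0
  | 0, g, hg => by simp [accepted]
  | n + 1, g, hg => by
    have ih := measurable_accepted_ofFn hθ (fun i => g i.succ) (fun i => hg _)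
    have hm : MeasurableSet {ω | θ (g 0 ω).1 < (g 0 ω).2} :=
      measurableSet_lt (hθ.comp (hg 0).fst) (hg 0).snd
    have : (fun ω => (accepted θ (List.ofFn fun i => g i ω)).foldr max 0) = fun ω =>
        if θ (g 0 ω).1 < (g 0 ω).2 then max (g 0 ω).2
          ((((List.ofFn fun i : Fin n => g i.succ ω).map Prod.snd).find?
            (fun v => decide ((g 0 ω).2 < v))).toList.foldr max 0) else
          (accepted θ (List.ofFn fun i => g i.succ ω)).foldr max 0 := by
      funext ω
      rw [List.ofFn_succ, accepted]
      by_cases h : θ (g 0 ω).1 < (g 0 ω).2 <;> simp [h]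
    rw [this]
    exact Measurable.ite hm ((hg 0).snd.max
      (measurable_find?_ofFn _ (fun i => hg _) _ (hg 0).snd)) ih

/-- `Tuple.sort` breaks ties by index, so being the sorting permutation amounts to finitely many
comparisons of arrival times. -/
theorem measurableSet_order_eq {n : ℕ} (σ : Equiv.Perm (Fin n)) :
    MeasurableSet {ω : Fin n → ℝ × ℝ | order ω = σ} := by
  have ht : ∀ i, Measurable fun ω : Fin n → ℝ × ℝ => (ω (σ i)).1 := fun i =>
    (measurable_pi_apply _).fst
  have h : Measurable fun ω : Fin n → ℝ × ℝ =>
      (∀ i j : Fin n, i ≤ j → (ω (σ i)).1 ≤ (ω (σ j)).1) ∧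
        ∀ i j : Fin n, i < j → (ω (σ i)).1 = (ω (σ j)).1 → σ i < σ j :=
    (Measurable.forall fun i => Measurable.forall fun j => measurable_const.imp
      (measurableSet_setOfPred.1 (measurableSet_le (ht i) (ht j)))).and
    (Measurable.forall fun i => Measurable.forall fun j => measurable_const.imp
      ((measurableSet_setOfPred.1 (measurableSet_eq_fun (ht i) (ht j))).imp measurable_const))
  convert measurableSet_setOfPred.2 h using 3 with ω
  rw [eq_comm, order, Tuple.eq_sort_iff]
  rfl

/-- The arrival order takes finitely many values, and once it is fixed the reward is built
recursively from measurable pieces. -/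
theorem measurable_reward {n : ℕ} {θ : ℝ → ℝ} (hθ : Measurable θ) :
    Measurable (reward (n := n) θ) := by
  classical
  have : reward (n := n) θ = fun ω => ∑ σ : Equiv.Perm (Fin n),
      if order ω = σ then (accepted θ (List.ofFn fun i => ω (σ i))).foldr max 0 else 0 := by
    funext ω
    rw [Finset.sum_ite_eq]
    simp [reward, arrivals, order]
  rw [this]
  refine Finset.measurable_fun_sum _ fun σ _ => Measurable.ite (measurableSet_order_eq σ)
    (measurable_accepted_ofFn hθ _ fun i => measurable_pi_apply _) measurable_const

/-! ### The law of an item, and products of it -/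

/-- The law of a pair (arrival time, value). -/
def itemLaw (μ : Measure ℝ) : Measure (ℝ × ℝ) :=
  (volume.restrict (Set.Icc (0 : ℝ) 1)).prod μ

instance : IsProbabilityMeasure (volume.restrict (Set.Icc (0 : ℝ) 1)) :=
  ⟨by simp⟩

instance (μ : Measure ℝ) [IsProbabilityMeasure μ] : IsProbabilityMeasure (itemLaw μ) := by
  unfold itemLaw; infer_instance

instance (μ : Measure ℝ) [IsProbabilityMeasure μ] (n : ℕ) :
    IsProbabilityMeasure (instanceLaw μ n) := by
  unfold instanceLaw; infer_instance

theorem instanceLaw_eq (μ : Measure ℝ) (n : ℕ) :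
    instanceLaw μ n = Measure.pi fun _ => itemLaw μ := rfl

theorem setLIntegral_itemLaw_fst (μ : Measure ℝ) [IsProbabilityMeasure μ] {J Y : Set ℝ}
    (hJ : J ⊆ Set.Icc 0 1) (hJm : MeasurableSet J) {g : ℝ → ENNReal} (hg : Measurable g) :
    ∫⁻ a in J ×ˢ Y, g a.1 ∂(itemLaw μ) = μ Y * ∫⁻ t in J, g t := by
  have h1 : (itemLaw μ).restrict (J ×ˢ Y) = (volume.restrict J).prod (μ.restrict Y) := by
    rw [itemLaw, ← Measure.prod_restrict, Measure.restrict_restrict hJm,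
      Set.inter_eq_left.2 hJ]
  rw [h1]
  have := lintegral_prod_mul (μ := volume.restrict J) (ν := μ.restrict Y) (f := g)
    (g := fun _ => 1) hg.aemeasurable aemeasurable_const
  simp only [mul_one, lintegral_const, Measure.restrict_apply_univ, one_mul] at this
  rw [this, mul_comm]

theorem itemLaw_real_Ioc_prod (μ : Measure ℝ) [IsProbabilityMeasure μ] {a b : ℝ} (Y : Set ℝ)
    (ha : 0 ≤ a) (hab : a ≤ b) (hb : b ≤ 1) :
    (itemLaw μ).real (Set.Ioc a b ×ˢ Y) = (b - a) * μ.real Y := by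
  have : Set.Ioc a b ∩ Set.Icc 0 1 = Set.Ioc a b :=
    Set.inter_eq_left.2 fun x hx => ⟨by linarith [hx.1], by linarith [hx.2]⟩
  rw [itemLaw, measureReal_prod_prod, measureReal_restrict_apply measurableSet_Ioc, this,
    Real.volume_real_Ioc_of_le hab]

theorem itemLaw_real_time_nonpos (μ : Measure ℝ) [IsProbabilityMeasure μ] :
    (itemLaw μ).real {x | x.1 ≤ 0} = 0 := by
  have h : {x : ℝ × ℝ | x.1 ≤ 0} = Set.Iic 0 ×ˢ Set.univ := by ext; simp
  have h2 : Set.Iic (0 : ℝ) ∩ Set.Icc 0 1 = {0} := by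
    ext x
    simp only [Set.mem_inter_iff, Set.mem_Iic, Set.mem_Icc, Set.mem_singleton_iff]
    constructor
    · rintro ⟨h1, h2, _⟩; linarith
    · rintro rfl; norm_num
  rw [h, itemLaw, measureReal_prod_prod, measureReal_restrict_apply measurableSet_Iic, h2]
  simp [measureReal_def]

/-! ### Events about one or two distinguished coordinates of a product measure -/

section Product

variable {α : Type*} [MeasurableSpace α] (ν : Measure α) [IsProbabilityMeasure ν]

theorem pi_real_forall_mem (n : ℕ) (D : Set α) :
    (Measure.pi fun _ : Fin n => ν).real {ω | ∀ r, ω r ∈ D} = ν.real D ^ n := by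
  have : {ω : Fin n → α | ∀ r, ω r ∈ D} = Set.univ.pi fun _ => D := by ext; simp
  rw [this, measureReal_def, Measure.pi_pi]
  simp [measureReal_def]

theorem pi_forall_mem (n : ℕ) (D : Set α) :
    (Measure.pi fun _ : Fin n => ν) {ω | ∀ r, ω r ∈ D} = ENNReal.ofReal (ν.real D ^ n) := by
  rw [← pi_real_forall_mem, ofReal_measureReal]

theorem pi_apply_split {n : ℕ} (i : Fin (n + 1)) {T : Set (α × (Fin n → α))}
    (hT : MeasurableSet T) :
    (Measure.pi fun _ : Fin (n + 1) => ν) {ω | (ω i, fun r => ω (i.succAbove r)) ∈ T} =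
      ∫⁻ a, (Measure.pi fun _ : Fin n => ν) {w | (a, w) ∈ T} ∂ν := by
  have h := measurePreserving_piFinSuccAbove (fun _ : Fin (n + 1) => ν) i
  have h2 := h.measure_preimage hT.nullMeasurableSet
  rw [Measure.prod_apply hT] at h2
  exact h2

/-- Given the value `a` of coordinate `i`, the other `n` coordinates are independent and each meets
the same constraint, whence the `n`-th power. -/
theorem pi_apply_one {n : ℕ} (i : Fin (n + 1)) {R : Set α} {C : Set (α × α)}
    (hR : MeasurableSet R) (hC : MeasurableSet C) :
    (Measure.pi fun _ : Fin (n + 1) => ν)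
        {ω | ω i ∈ R ∧ ∀ r, (ω i, ω (i.succAbove r)) ∈ C} =
      ∫⁻ a in R, ENNReal.ofReal (ν.real {y | (a, y) ∈ C} ^ n) ∂ν := by
  have hT : MeasurableSet {x : α × (Fin n → α) | x.1 ∈ R ∧ ∀ r, (x.1, x.2 r) ∈ C} := by
    refine (measurable_fst hR).inter (measurableSet_setOfPred.2 (Measurable.forall fun r => ?_))
    exact measurableSet_setOfPred.1
      ((measurable_fst.prodMk ((measurable_pi_apply r).comp measurable_snd)) hC)
  have h := pi_apply_split ν i hT
  refine h.trans ?_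
  rw [← lintegral_indicator hR]
  refine lintegral_congr fun a => ?_
  by_cases ha : a ∈ R
  · rw [Set.indicator_of_mem ha, ← pi_forall_mem]
    simp [ha]
  · simp [ha]

theorem pi_apply_two {n : ℕ} (i : Fin (n + 2)) (s : Fin (n + 1)) {R : Set α} {R' : Set (α × α)}
    {C : Set (α × α × α)} (hR : MeasurableSet R) (hR' : MeasurableSet R') (hC : MeasurableSet C) :
    (Measure.pi fun _ : Fin (n + 2) => ν)
        {ω | ω i ∈ R ∧ (ω i, ω (i.succAbove s)) ∈ R' ∧
          ∀ r, (ω i, ω (i.succAbove s), ω (i.succAbove (s.succAbove r))) ∈ C} =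
      ∫⁻ a in R, ∫⁻ b in {b | (a, b) ∈ R'},
        ENNReal.ofReal (ν.real {y | (a, b, y) ∈ C} ^ n) ∂ν ∂ν := by
  have hT : MeasurableSet {x : α × (Fin (n + 1) → α) | x.1 ∈ R ∧ (x.1, x.2 s) ∈ R' ∧
      ∀ r, (x.1, x.2 s, x.2 (s.succAbove r)) ∈ C} := by
    refine (measurable_fst hR).inter (MeasurableSet.inter ?_
      (measurableSet_setOfPred.2 (Measurable.forall fun r => ?_)))
    · exact (measurable_fst.prodMk ((measurable_pi_apply s).comp measurable_snd)) hR'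
    · exact measurableSet_setOfPred.1 ((measurable_fst.prodMk
        (((measurable_pi_apply s).comp measurable_snd).prodMk
          ((measurable_pi_apply (s.succAbove r)).comp measurable_snd))) hC)
  have h := pi_apply_split ν i hT
  refine h.trans ?_
  rw [← lintegral_indicator hR]
  refine lintegral_congr fun a => ?_
  by_cases ha : a ∈ R
  · rw [Set.indicator_of_mem ha]
    have h1 : MeasurableSet {b | (a, b) ∈ R'} := measurable_prodMk_left hR'
    have h2 : MeasurableSet {y : α × α | (a, y) ∈ C} := measurable_prodMk_left hC
    refine Eq.trans ?_ (pi_apply_one ν s h1 h2)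
    simp [ha]
  · simp [ha]

end Product

/-- The one integral behind all acceptance probabilities. `K` and `γ` are there for the second
acceptance, where integrating over the later arrival time leaves a factor and a constant to be
subtracted. -/
theorem setLIntegral_sub_mul_pow {a b : ℝ} (hab : a ≤ b) {p : ℝ} (hp : 0 < p) (α γ K : ℝ) (n : ℕ)
    (hnn : ∀ t ∈ Set.Ioc a b, 0 ≤ K * ((α - p * (t - a)) ^ n - γ)) :
    ∫⁻ t in Set.Ioc a b, ENNReal.ofReal (K * ((α - p * (t - a)) ^ n - γ)) =
      ENNReal.ofReal (K * ((α ^ (n + 1) - (α - p * (b - a)) ^ (n + 1)) / ((n + 1) * p)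
        - γ * (b - a))) := by
  have hcont : Continuous fun t : ℝ => K * ((α - p * (t - a)) ^ n - γ) := by fun_prop
  have hintegrable : IntegrableOn (fun t : ℝ => K * ((α - p * (t - a)) ^ n - γ)) (Set.Ioc a b) :=
    (hcont.integrableOn_Icc).mono_set Set.Ioc_subset_Icc_self
  rw [← ofReal_integral_eq_lintegral_ofReal hintegrable
    ((ae_restrict_iff' measurableSet_Ioc).2 (Filter.Eventually.of_forall hnn)),
    ← intervalIntegral.integral_of_le hab]
  congr 1
  have hd : ∀ t ∈ Set.uIcc a b, HasDerivAt
      (fun t : ℝ => K * (-(α - p * (t - a)) ^ (n + 1) / ((n + 1) * p) - γ * t))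
      (K * ((α - p * (t - a)) ^ n - γ)) t := by
    intro t _
    have h1 : HasDerivAt (fun t : ℝ => α - p * (t - a)) (-p) t := by
      simpa using (((hasDerivAt_id t).sub_const a).const_mul p).const_sub α
    have h2 := ((h1.pow (n + 1)).neg.div_const (((n : ℝ) + 1) * p)).sub
      ((hasDerivAt_id t).const_mul γ)
    refine (h2.const_mul K).congr_deriv ?_
    have : (n : ℝ) + 1 ≠ 0 := by positivity
    push_cast
    simp only [mul_one]
    field_simp
  rw [intervalIntegral.integral_eq_sub_of_hasDerivAt hd (hcont.intervalIntegrable _ _)]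
  have : (n : ℝ) + 1 ≠ 0 := by positivity
  field_simp
  ring

/-! ### Early acceptance -/

/-- The items that arrive by time `t` with a value above their threshold. -/
def early (θ : ℝ → ℝ) (t : ℝ) : Set (ℝ × ℝ) := {x | x.1 ≤ t ∧ θ x.1 < x.2}

/-- The `k`-th of `m` slots of time. -/
def slot (m k : ℕ) : Set ℝ := Set.Ioc (((k : ℝ) - 1) / m) (k / m)

/-- The sum of the first `k - 1` values of `p`, divided by `m`. -/
def cum (m : ℕ) (p : ℕ → ℝ) (k : ℕ) : ℝ := 1 / (m : ℝ) * ∑ r ∈ Finset.Ico 1 k, p r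

theorem cum_succ (m : ℕ) (p : ℕ → ℝ) {k : ℕ} (hk : 1 ≤ k) :
    cum m p (k + 1) = cum m p k + p k * (1 / m) := by
  rw [cum, cum, Finset.sum_Ico_succ_top hk]; ring

theorem measurableSet_early {θ : ℝ → ℝ} (hθ : Measurable θ) :
    MeasurableSet {x : ℝ × ℝ × ℝ | x.2 ∈ early θ x.1} :=
  (measurableSet_le measurable_snd.fst measurable_fst).inter
    (measurableSet_lt (hθ.comp measurable_snd.fst) measurable_snd.snd)

theorem measurableSet_early_section {θ : ℝ → ℝ} (hθ : Measurable θ) (t : ℝ) :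
    MeasurableSet (early θ t) :=
  measurable_prodMk_left (x := t) (measurableSet_early hθ)

theorem stepThreshold_of_mem_slot {m k : ℕ} (hm : 0 < m) (hk : 1 ≤ k) (τ : ℕ → ℝ) {t : ℝ}
    (ht : t ∈ slot m k) : stepThreshold m τ t = τ k := by
  have hm' : (0 : ℝ) < m := by exact_mod_cast hm
  have h1 := (div_lt_iff₀ hm').1 ht.1
  have h2 := (le_div_iff₀ hm').1 ht.2
  have : ⌈t * m⌉₊ = k := by
    rw [Nat.ceil_eq_iff (by omega)]
    rw [Nat.cast_sub hk]
    exact ⟨by simpa using h1, h2⟩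
  rw [stepThreshold, this]

theorem slot_bounds {m k : ℕ} (hm : 0 < m) (hk : 1 ≤ k) (hkm : k ≤ m) :
    0 ≤ ((k : ℝ) - 1) / m ∧ ((k : ℝ) - 1) / m ≤ k / m ∧ (k : ℝ) / m ≤ 1 ∧
      (k : ℝ) / m - ((k : ℝ) - 1) / m = 1 / m := by
  have hm' : (0 : ℝ) < m := by exact_mod_cast hm
  have hk' : (1 : ℝ) ≤ k := by exact_mod_cast hk
  have hkm' : (k : ℝ) ≤ m := by exact_mod_cast hkm
  refine ⟨div_nonneg (by linarith) hm'.le, ?_, (div_le_one hm').2 hkm', by field_simp; ring⟩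
  gcongr
  linarith

theorem early_eq_union {m k : ℕ} (hm : 0 < m) (hk : 1 ≤ k) (τ : ℕ → ℝ) {t : ℝ}
    (ht : t ∈ Set.Icc (((k : ℝ) - 1) / m) (k / m)) :
    early (stepThreshold m τ) t = early (stepThreshold m τ) (((k : ℝ) - 1) / m) ∪
      Set.Ioc (((k : ℝ) - 1) / m) t ×ˢ Set.Ioi (τ k) := by
  ext x
  by_cases hx : x.1 ≤ ((k : ℝ) - 1) / m
  · simp [early, hx, hx.trans ht.1, not_lt.2 hx]
  · have hx' := not_le.1 hx
    by_cases hxt : x.1 ≤ t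
    · have := stepThreshold_of_mem_slot hm hk τ (t := x.1) ⟨hx', hxt.trans ht.2⟩
      simp [early, hx, hx', hxt, this]
    · simp [early, hx, hxt]

theorem itemLaw_real_early_step (μ : Measure ℝ) [IsProbabilityMeasure μ] {m k : ℕ} (hm : 0 < m)
    (hk : 1 ≤ k) (hkm : k ≤ m) (τ : ℕ → ℝ) {t : ℝ}
    (ht : t ∈ Set.Icc (((k : ℝ) - 1) / m) (k / m)) :
    (itemLaw μ).real (early (stepThreshold m τ) t) =
      (itemLaw μ).real (early (stepThreshold m τ) (((k : ℝ) - 1) / m)) +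
        μ.real (Set.Ioi (τ k)) * (t - ((k : ℝ) - 1) / m) := by
  obtain ⟨h0, h1, h2, -⟩ := slot_bounds hm hk hkm
  rw [early_eq_union hm hk τ ht, measureReal_union _ (measurableSet_Ioc.prod measurableSet_Ioi),
    itemLaw_real_Ioc_prod μ _ h0 ht.1 (ht.2.trans h2), mul_comm]
  rw [Set.disjoint_left]
  rintro x hx ⟨hx', -⟩
  exact absurd hx.1 (not_le.2 hx'.1)

/-- Slot `r` contributes its length `1 / m` times the tail at `τ r`. Slots are open on the left, so
arrival at time `0` belongs to none of them, but it has mass zero. -/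
theorem itemLaw_real_early_grid (μ : Measure ℝ) [IsProbabilityMeasure μ] {m : ℕ} (hm : 0 < m)
    (τ : ℕ → ℝ) {k : ℕ} (hk : 1 ≤ k) (hkm : k ≤ m + 1) :
    (itemLaw μ).real (early (stepThreshold m τ) (((k : ℝ) - 1) / m)) =
      cum m (fun r => μ.real (Set.Ioi (τ r))) k := by
  induction k, hk using Nat.le_induction with
  | base =>
    have h : early (stepThreshold m τ) (((1 : ℕ) - 1 : ℝ) / m) ⊆ {x | x.1 ≤ 0} := by
      intro x hx
      simpa using hx.1
    have := measureReal_mono (μ := itemLaw μ) h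
    rw [itemLaw_real_time_nonpos] at this
    rw [le_antisymm this measureReal_nonneg]
    simp [cum]
  | succ k hk ih =>
    have hkm' : k ≤ m := by omega
    obtain ⟨h0, h1, h2, h3⟩ := slot_bounds hm hk hkm'
    have := itemLaw_real_early_step μ hm hk hkm' τ (t := (k : ℝ) / m) ⟨h1, le_rfl⟩
    rw [cum_succ _ _ hk, ← ih (by omega), ← h3, ← this]
    push_cast
    rw [add_sub_cancel_right]

theorem itemLaw_real_early (μ : Measure ℝ) [IsProbabilityMeasure μ] {m k : ℕ} (hm : 0 < m)
    (hk : 1 ≤ k) (hkm : k ≤ m) (τ : ℕ → ℝ) {t : ℝ}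
    (ht : t ∈ Set.Icc (((k : ℝ) - 1) / m) (k / m)) :
    (itemLaw μ).real (early (stepThreshold m τ) t) =
      cum m (fun r => μ.real (Set.Ioi (τ r))) k +
        μ.real (Set.Ioi (τ k)) * (t - ((k : ℝ) - 1) / m) := by
  rw [itemLaw_real_early_step μ hm hk hkm τ ht, itemLaw_real_early_grid μ hm τ hk (by omega)]

/-- Some item is accepted during the first `j - 1` slots. -/
theorem instanceLaw_real_exists_early (μ : Measure ℝ) [IsProbabilityMeasure μ] {m : ℕ} (hm : 0 < m)
    (τ : ℕ → ℝ) {j : ℕ} (hj : 1 ≤ j) (hjm : j ≤ m + 1) (n : ℕ) :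
    (instanceLaw μ n).real {ω | ∃ i, ω i ∈ early (stepThreshold m τ) (((j : ℝ) - 1) / m)} =
      1 - (1 - cum m (fun r => μ.real (Set.Ioi (τ r))) j) ^ n := by
  have hme := measurableSet_early_section (measurable_stepThreshold m τ) (((j : ℝ) - 1) / m)
  have hcompl : {ω : Fin n → ℝ × ℝ | ∃ i, ω i ∈ early (stepThreshold m τ) (((j : ℝ) - 1) / m)} =
      {ω | ∀ i, ω i ∈ (early (stepThreshold m τ) (((j : ℝ) - 1) / m))ᶜ}ᶜ := by
    ext ω; simp
  have hmeas : MeasurableSet {ω : Fin n → ℝ × ℝ |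
      ∀ i, ω i ∈ (early (stepThreshold m τ) (((j : ℝ) - 1) / m))ᶜ} :=
    measurableSet_setOfPred.2 (Measurable.forall fun i =>
      measurableSet_setOfPred.1 ((measurable_pi_apply i) hme.compl))
  rw [hcompl, probReal_compl_eq_one_sub hmeas, instanceLaw_eq, pi_real_forall_mem,
    probReal_compl_eq_one_sub hme, itemLaw_real_early_grid μ hm τ hj hjm]

/-! ### Acceptance of a single good item -/

/-- Item `i` arrives in slot `k` with a value above `v`, and no other item is accepted earlier. -/
def goodFirst (m : ℕ) (τ : ℕ → ℝ) (v : ℝ) {n : ℕ} (k : ℕ) (i : Fin (n + 1)) :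
    Set (Fin (n + 1) → ℝ × ℝ) :=
  {ω | ω i ∈ slot m k ×ˢ Set.Ioi v ∧
    ∀ r, (ω i, ω (i.succAbove r)) ∈ {x : (ℝ × ℝ) × (ℝ × ℝ) |
      x.2 ∉ early (stepThreshold m τ) x.1.1}}

theorem measurableSet_early_compl (m : ℕ) (τ : ℕ → ℝ) : MeasurableSet
    {x : (ℝ × ℝ) × (ℝ × ℝ) | x.2 ∉ early (stepThreshold m τ) x.1.1} :=
  ((measurable_fst.fst.prodMk measurable_snd)
    (measurableSet_early (measurable_stepThreshold m τ))).compl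

theorem measurableSet_goodFirst (m : ℕ) (τ : ℕ → ℝ) (v : ℝ) {n : ℕ} (k : ℕ) (i : Fin (n + 1)) :
    MeasurableSet (goodFirst m τ v k i) := by
  refine MeasurableSet.inter ((measurable_pi_apply i) (measurableSet_Ioc.prod measurableSet_Ioi))
    (measurableSet_setOfPred.2 (Measurable.forall fun r => ?_))
  exact measurableSet_setOfPred.1 (((measurable_pi_apply i).prodMk
    (measurable_pi_apply (i.succAbove r))) (measurableSet_early_compl m τ))

theorem slot_subset {m k : ℕ} (hm : 0 < m) (hk : 1 ≤ k) (hkm : k ≤ m) :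
    slot m k ⊆ Set.Icc 0 1 := by
  obtain ⟨h0, h1, h2, -⟩ := slot_bounds hm hk hkm
  exact fun x hx => ⟨h0.trans hx.1.le, hx.2.trans h2⟩

section Laws

variable (μ : Measure ℝ) [IsProbabilityMeasure μ] {m : ℕ} (τ : ℕ → ℝ)

/-- The acceptance probability accumulated over the first `k - 1` slots, plus what an item would
contribute if threshold `k` stayed in force until the end. -/
def cumRest (m : ℕ) (p : ℕ → ℝ) (k : ℕ) : ℝ := cum m p k + p k * (1 - ((k : ℝ) - 1) / m)

/-- If `i` arrives at time `t`, the other `n` items must each avoid `early _ t`, whose mass is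
affine in `t` on the slot. The value of `i` contributes only the factor `P(X > v)`. -/
theorem instanceLaw_real_goodFirst (hm : 0 < m) {k : ℕ} (hk : 1 ≤ k) (hkm : k ≤ m)
    (hp : 0 < μ.real (Set.Ioi (τ k))) (v : ℝ) {n : ℕ} (i : Fin (n + 1)) :
    (instanceLaw μ (n + 1)).real (goodFirst m τ v k i) =
      μ.real (Set.Ioi v) *
        (((1 - cum m (fun r => μ.real (Set.Ioi (τ r))) k) ^ (n + 1) -
          (1 - cum m (fun r => μ.real (Set.Ioi (τ r))) (k + 1)) ^ (n + 1)) /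
            ((n + 1) * μ.real (Set.Ioi (τ k)))) := by
  set p : ℕ → ℝ := fun r => μ.real (Set.Ioi (τ r)) with hpdef
  obtain ⟨h0, h1, h2, h3⟩ := slot_bounds hm hk hkm
  have hθ := measurable_stepThreshold m τ
  have hR : MeasurableSet (slot m k ×ˢ Set.Ioi v) := measurableSet_Ioc.prod measurableSet_Ioi
  have hcomp : ∀ t ∈ slot m k, (itemLaw μ).real (early (stepThreshold m τ) t)ᶜ =
      (1 - cum m p k) - p k * (t - ((k : ℝ) - 1) / m) := by
    intro t ht
    rw [probReal_compl_eq_one_sub (measurableSet_early_section hθ t),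
      itemLaw_real_early μ hm hk hkm τ ⟨ht.1.le, ht.2⟩]
    ring
  have key : (instanceLaw μ (n + 1)) (goodFirst m τ v k i) = μ (Set.Ioi v) *
      ∫⁻ t in slot m k, ENNReal.ofReal
        (1 * (((1 - cum m p k) - p k * (t - ((k : ℝ) - 1) / m)) ^ n - 0)) := by
    rw [instanceLaw_eq]
    refine (pi_apply_one (itemLaw μ) i hR (measurableSet_early_compl m τ)).trans ?_
    rw [← setLIntegral_itemLaw_fst μ (slot_subset hm hk hkm) measurableSet_Ioc (by fun_prop)]
    refine setLIntegral_congr_fun hR fun a ha => ?_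
    simp only [one_mul, sub_zero]
    rw [← hcomp a.1 ha.1]
    rfl
  have hnn : ∀ t ∈ Set.Ioc (((k : ℝ) - 1) / m) (k / m),
      0 ≤ 1 * (((1 - cum m p k) - p k * (t - ((k : ℝ) - 1) / m)) ^ n - 0) := by
    intro t ht
    rw [← hcomp t ht, one_mul, sub_zero]
    positivity
  rw [slot, setLIntegral_sub_mul_pow h1 hp _ _ _ _ hnn] at key
  rw [measureReal_def, key, ENNReal.toReal_mul, ENNReal.toReal_ofReal, ← measureReal_def, h3]
  · rw [cum_succ _ _ hk]
    ring
  · have hA : 0 ≤ 1 - cum m p k - p k * (k / m - ((k : ℝ) - 1) / m) := by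
      rw [h3, sub_sub, ← cum_succ _ _ hk]
      have := itemLaw_real_early_grid μ hm τ (k := k + 1) (by omega) (by omega)
      rw [← this]
      linarith [measureReal_le_one (μ := itemLaw μ)
        (s := early (stepThreshold m τ) ((((k + 1 : ℕ) : ℝ) - 1) / m))]
    have hle : 1 - cum m p k - p k * (k / m - ((k : ℝ) - 1) / m) ≤ 1 - cum m p k := by
      have : 0 ≤ p k * (k / m - ((k : ℝ) - 1) / m) := mul_nonneg hp.le (by linarith)
      linarith
    have := pow_le_pow_left₀ hA hle (n + 1)
    have h4 : 0 ≤ ((n : ℝ) + 1) * p k := by positivity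
    simp only [one_mul, zero_mul, sub_zero]
    exact div_nonneg (by linarith) h4

/-! ### Acceptance of a good item after a poor one -/

/-- Item `i` arrives in slot `k` with a value between `τ k` and `v`, the item `i.succAbove s`
arrives later with a value above `v`, and no other item is accepted before `i` or exceeds `τ k`
between the two. -/
def goodSecond (m : ℕ) (τ : ℕ → ℝ) (v : ℝ) {n : ℕ} (k : ℕ) (i : Fin (n + 2)) (s : Fin (n + 1)) :
    Set (Fin (n + 2) → ℝ × ℝ) :=
  {ω | ω i ∈ slot m k ×ˢ Set.Ioc (τ k) v ∧
    (ω i, ω (i.succAbove s)) ∈ {x : (ℝ × ℝ) × (ℝ × ℝ) | x.2 ∈ Set.Ioc x.1.1 1 ×ˢ Set.Ioi v} ∧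
    ∀ r, (ω i, ω (i.succAbove s), ω (i.succAbove (s.succAbove r))) ∈
      {x : (ℝ × ℝ) × (ℝ × ℝ) × (ℝ × ℝ) | x.2.2 ∉ early (stepThreshold m τ) x.1.1 ∪
        Set.Ioc x.1.1 x.2.1.1 ×ˢ Set.Ioi (τ k)}}

theorem measurableSet_later (v : ℝ) : MeasurableSet
    {x : (ℝ × ℝ) × (ℝ × ℝ) | x.2 ∈ Set.Ioc x.1.1 1 ×ˢ Set.Ioi v} :=
  ((measurableSet_lt measurable_fst.fst measurable_snd.fst).inter
    (measurableSet_le measurable_snd.fst measurable_const)).inter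
    (measurableSet_lt measurable_const measurable_snd.snd)

theorem measurableSet_between_compl (m : ℕ) (τ : ℕ → ℝ) (k : ℕ) : MeasurableSet
    {x : (ℝ × ℝ) × (ℝ × ℝ) × (ℝ × ℝ) | x.2.2 ∉ early (stepThreshold m τ) x.1.1 ∪
        Set.Ioc x.1.1 x.2.1.1 ×ˢ Set.Ioi (τ k)} := by
  refine MeasurableSet.compl (MeasurableSet.union ?_ ?_)
  · exact (measurable_fst.fst.prodMk measurable_snd.snd)
      (measurableSet_early (measurable_stepThreshold m τ))
  · exact ((measurableSet_lt measurable_fst.fst measurable_snd.snd.fst).inter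
      (measurableSet_le measurable_snd.snd.fst measurable_snd.fst.fst)).inter
      (measurableSet_lt measurable_const measurable_snd.snd.snd)

theorem measurableSet_goodSecond (m : ℕ) (τ : ℕ → ℝ) (v : ℝ) {n : ℕ} (k : ℕ) (i : Fin (n + 2))
    (s : Fin (n + 1)) : MeasurableSet (goodSecond m τ v k i s) := by
  refine MeasurableSet.inter ((measurable_pi_apply i) (measurableSet_Ioc.prod measurableSet_Ioc))
    (MeasurableSet.inter ?_ (measurableSet_setOfPred.2 (Measurable.forall fun r => ?_)))
  · have h : Measurable fun ω : Fin (n + 2) → ℝ × ℝ => (ω i, ω (i.succAbove s)) := by fun_prop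
    exact h (measurableSet_later v)
  · exact measurableSet_setOfPred.1 (((measurable_pi_apply i).prodMk
      ((measurable_pi_apply (i.succAbove s)).prodMk
        (measurable_pi_apply (i.succAbove (s.succAbove r)))))
      (measurableSet_between_compl m τ k))

/-- With arrivals at `t < u`, each other item must avoid the items early at `t` and those above `τ
k` in `(t, u]`, a set of mass affine in `u`. Integrating over `u ∈ (t, 1]` and then over `t` in the
slot gives the formula. -/
theorem instanceLaw_real_goodSecond (hm : 0 < m) {k : ℕ} (hk : 1 ≤ k) (hkm : k ≤ m)
    (hp : 0 < μ.real (Set.Ioi (τ k))) {v : ℝ} (hv : τ k ≤ v) {n : ℕ} (i : Fin (n + 2))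
    (s : Fin (n + 1)) :
    (μ.real (Set.Ioi (τ k)) - μ.real (Set.Ioi v)) *
        (μ.real (Set.Ioi v) / ((n + 1) * μ.real (Set.Ioi (τ k))) *
        (((1 - cum m (fun r => μ.real (Set.Ioi (τ r))) k) ^ (n + 2) -
          (1 - cum m (fun r => μ.real (Set.Ioi (τ r))) (k + 1)) ^ (n + 2)) /
            ((n + 2) * μ.real (Set.Ioi (τ k))) -
          (1 - cumRest m (fun r => μ.real (Set.Ioi (τ r))) k) ^ (n + 1) * (1 / m))) ≤
      (instanceLaw μ (n + 2)).real (goodSecond m τ v k i s) := by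
  set p : ℕ → ℝ := fun r => μ.real (Set.Ioi (τ r)) with hpdef
  set q : ℝ := μ.real (Set.Ioi v) with hq
  have hpk : 0 < p k := hp
  obtain ⟨h0, h1, h2, h3⟩ := slot_bounds hm hk hkm
  have hθ := measurable_stepThreshold m τ
  have hR : MeasurableSet (slot m k ×ˢ Set.Ioc (τ k) v) := measurableSet_Ioc.prod measurableSet_Ioc
  have hcomp : ∀ t ∈ slot m k, ∀ u ∈ Set.Ioc t 1,
      (itemLaw μ).real (early (stepThreshold m τ) t ∪ Set.Ioc t u ×ˢ Set.Ioi (τ k))ᶜ =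
      (1 - cum m p k - p k * (t - ((k : ℝ) - 1) / m)) - p k * (u - t) := by
    intro t ht u hu
    have hms : MeasurableSet (Set.Ioc t u ×ˢ Set.Ioi (τ k)) :=
      measurableSet_Ioc.prod measurableSet_Ioi
    rw [probReal_compl_eq_one_sub ((measurableSet_early_section hθ t).union hms),
      measureReal_union _ hms, itemLaw_real_early μ hm hk hkm τ ⟨ht.1.le, ht.2⟩,
      itemLaw_real_Ioc_prod μ _ (h0.trans ht.1.le) hu.1.le hu.2]
    · ring
    · rw [Set.disjoint_left]
      rintro x hx ⟨hx', -⟩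
      exact absurd hx.1 (not_le.2 hx'.1)
  have hinner : ∀ a ∈ slot m k ×ˢ Set.Ioc (τ k) v,
      ∫⁻ b in {b | (a, b) ∈ {x : (ℝ × ℝ) × (ℝ × ℝ) | x.2 ∈ Set.Ioc x.1.1 1 ×ˢ Set.Ioi v}},
        ENNReal.ofReal ((itemLaw μ).real {y | (a, b, y) ∈
          {x : (ℝ × ℝ) × (ℝ × ℝ) × (ℝ × ℝ) | x.2.2 ∉ early (stepThreshold m τ) x.1.1 ∪
        Set.Ioc x.1.1 x.2.1.1 ×ˢ Set.Ioi (τ k)}} ^ n) ∂(itemLaw μ) =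
      ENNReal.ofReal (q / ((n + 1) * p k) *
        ((1 - cum m p k - p k * (a.1 - ((k : ℝ) - 1) / m)) ^ (n + 1) -
          (1 - cumRest m p k) ^ (n + 1))) := by
    rintro ⟨t, x⟩ ⟨ht : t ∈ slot m k, -⟩
    have ht1 : t ≤ 1 := ht.2.trans h2
    have hnn : ∀ u ∈ Set.Ioc t 1, 0 ≤ 1 *
        (((1 - cum m p k - p k * (t - ((k : ℝ) - 1) / m)) - p k * (u - t)) ^ n - 0) := by
      intro u hu
      rw [← hcomp t ht u hu, one_mul, sub_zero]
      positivity
    have hsub : Set.Ioc t 1 ⊆ Set.Icc 0 1 := fun u hu => ⟨(h0.trans ht.1.le).trans hu.1.le, hu.2⟩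
    have hstep : ∫⁻ b in Set.Ioc t 1 ×ˢ Set.Ioi v,
        ENNReal.ofReal ((itemLaw μ).real
          (early (stepThreshold m τ) t ∪ Set.Ioc t b.1 ×ˢ Set.Ioi (τ k))ᶜ ^ n) ∂(itemLaw μ) =
        μ (Set.Ioi v) * ∫⁻ u in Set.Ioc t 1, ENNReal.ofReal (1 *
        (((1 - cum m p k - p k * (t - ((k : ℝ) - 1) / m)) - p k * (u - t)) ^ n - 0)) := by
      rw [← setLIntegral_itemLaw_fst μ hsub measurableSet_Ioc (by fun_prop)]
      refine setLIntegral_congr_fun (measurableSet_Ioc.prod measurableSet_Ioi) fun b hb => ?_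
      simp only [one_mul, sub_zero]
      rw [← hcomp t ht b.1 hb.1]
    refine hstep.trans ?_
    rw [setLIntegral_sub_mul_pow ht1 hpk _ _ _ _ hnn, ← ofReal_measureReal (s := Set.Ioi v),
      ← ENNReal.ofReal_mul measureReal_nonneg]
    congr 1
    -- At the endpoint `u = 1` the dependence on `t` cancels, so the subtracted power is a constant
    -- in the outer integral.
    have : 1 - cum m p k - p k * (t - ((k : ℝ) - 1) / m) - p k * (1 - t) =
        1 - cumRest m p k := by
      rw [cumRest]; ring
    rw [this]
    ring
  have key : (instanceLaw μ (n + 2)) (goodSecond m τ v k i s) = μ (Set.Ioc (τ k) v) *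
      ∫⁻ t in slot m k, ENNReal.ofReal (q / ((n + 1) * p k) *
        ((1 - cum m p k - p k * (t - ((k : ℝ) - 1) / m)) ^ (n + 1) -
          (1 - cumRest m p k) ^ (n + 1))) := by
    rw [instanceLaw_eq]
    refine (pi_apply_two (itemLaw μ) i s hR (measurableSet_later v)
      (measurableSet_between_compl m τ k)).trans ?_
    rw [← setLIntegral_itemLaw_fst μ (slot_subset hm hk hkm) measurableSet_Ioc (by fun_prop)]
    exact setLIntegral_congr_fun hR hinner
  have hnn : ∀ t ∈ Set.Ioc (((k : ℝ) - 1) / m) (k / m), 0 ≤ q / ((n + 1) * p k) *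
        ((1 - cum m p k - p k * (t - ((k : ℝ) - 1) / m)) ^ (n + 1) -
          (1 - cumRest m p k) ^ (n + 1)) := by
    intro t ht
    have ht1 : t ≤ 1 := ht.2.trans h2
    have hrest : 1 - cumRest m p k =
        1 - cum m p k - p k * (t - ((k : ℝ) - 1) / m) - p k * (1 - t) := by
      rw [cumRest]; ring
    have hnonneg : 0 ≤ 1 - cumRest m p k := by
      rcases ht1.lt_or_eq with h | h
      · rw [hrest, ← hcomp t ht 1 ⟨h, le_rfl⟩]
        positivity
      · have := itemLaw_real_early μ hm hk hkm τ ⟨ht.1.le, ht.2⟩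
        rw [hrest, h]
        have h5 := measureReal_le_one (μ := itemLaw μ) (s := early (stepThreshold m τ) t)
        rw [this, h] at h5
        linarith
    have hle : 1 - cumRest m p k ≤ 1 - cum m p k - p k * (t - ((k : ℝ) - 1) / m) := by
      have := mul_nonneg hpk.le (sub_nonneg.2 ht1)
      linarith
    have hpow := pow_le_pow_left₀ hnonneg hle (n + 1)
    have hq0 : 0 ≤ q := measureReal_nonneg
    exact mul_nonneg (by positivity) (by linarith)
  rw [slot, setLIntegral_sub_mul_pow h1 hpk _ _ _ _ hnn, h3] at key
  have hIoc : μ.real (Set.Ioc (τ k) v) = p k - q := by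
    have h6 := measureReal_union (μ := μ) (s₁ := Set.Ioc (τ k) v) (s₂ := Set.Ioi v)
      (Set.Ioc_disjoint_Ioi le_rfl) measurableSet_Ioi
    rw [Set.Ioc_union_Ioi_eq_Ioi hv] at h6
    simp only [hpdef, hq]
    linarith
  rw [measureReal_def (instanceLaw μ (n + 2)), key, ENNReal.toReal_mul, ENNReal.toReal_ofReal',
    ← measureReal_def, hIoc, show μ.real (Set.Ioi (τ k)) = p k from rfl]
  have hpq : 0 ≤ p k - q := hIoc ▸ measureReal_nonneg
  refine mul_le_mul_of_nonneg_left ?_ hpq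
  -- `ENNReal.toReal_ofReal'` yields a maximum with `0`; only the lower bound is needed, so no sign
  -- has to be checked.
  refine le_max_of_le_left (le_of_eq ?_)
  rw [cum_succ _ _ hk]
  push_cast
  ring

end Laws

/-! ### The probability of a reward above a given value -/

/-- The event that the reward exceeds `v` because item `i`, arriving in slot `k`, is accepted first,
either on its own account (`none`) or by being followed by another item (`some s`). -/
def goodEvent (m : ℕ) (τ : ℕ → ℝ) (v : ℝ) {n : ℕ} (k : ℕ) (i : Fin (n + 2)) :
    Option (Fin (n + 1)) → Set (Fin (n + 2) → ℝ × ℝ)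
  | none => goodFirst m τ v k i
  | some s => goodSecond m τ v k i s

theorem measurableSet_goodEvent (m : ℕ) (τ : ℕ → ℝ) (v : ℝ) {n : ℕ} (k : ℕ) (i : Fin (n + 2)) :
    ∀ o : Option (Fin (n + 1)), MeasurableSet (goodEvent m τ v k i o)
  | none => measurableSet_goodFirst m τ v k i
  | some s => measurableSet_goodSecond m τ v k i s

theorem first_of_mem_goodEvent {m : ℕ} {τ : ℕ → ℝ} {v : ℝ} {n k : ℕ} {i : Fin (n + 2)}
    (hv : τ k ≤ v) {o : Option (Fin (n + 1))} {ω : Fin (n + 2) → ℝ × ℝ}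
    (hω : ω ∈ goodEvent m τ v k i o) :
    (ω i).1 ∈ slot m k ∧ τ k < (ω i).2 ∧
      ∀ r, r ≠ i → ω r ∉ early (stepThreshold m τ) (ω i).1 := by
  cases o with
  | none =>
    obtain ⟨⟨h1, h2⟩, h3⟩ := hω
    refine ⟨h1, hv.trans_lt h2, fun r hr => ?_⟩
    obtain ⟨z, rfl⟩ := Fin.exists_succAbove_eq hr
    exact h3 z
  | some s =>
    obtain ⟨⟨h1, h2⟩, h3, h4⟩ := hω
    refine ⟨h1, h2.1, fun r hr => ?_⟩
    obtain ⟨z, rfl⟩ := Fin.exists_succAbove_eq hr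
    by_cases hz : z = s
    · subst hz
      exact fun h => absurd h.1 (not_le.2 h3.1.1)
    · obtain ⟨y, rfl⟩ := Fin.exists_succAbove_eq hz
      exact fun h => h4 y (Or.inl h)

theorem goodEvent_subset {m : ℕ} (hm : 0 < m) {τ : ℕ → ℝ} {v : ℝ} {n k : ℕ} (hk : 1 ≤ k)
    {i : Fin (n + 2)} (hv : τ k ≤ v) (o : Option (Fin (n + 1))) :
    goodEvent m τ v k i o ⊆ {ω | v < reward (stepThreshold m τ) ω} := by
  intro ω hω
  obtain ⟨h1, h2, h3⟩ := first_of_mem_goodEvent hv hω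
  have hθ := stepThreshold_of_mem_slot hm hk τ h1
  have hi : stepThreshold m τ (ω i).1 < (ω i).2 := hθ ▸ h2
  cases o with
  | none =>
    have hvi : v < (ω i).2 := hω.1.2
    exact hvi.trans_le (le_reward_of_first _ ω i hi h3)
  | some s =>
    obtain ⟨⟨-, h5⟩, ⟨h6, h7⟩, h4⟩ := hω
    refine lt_of_lt_of_le h7 (le_reward_of_second _ ω i (i.succAbove s) hi h3 h6.1
      (h5.2.trans_lt h7) fun r hr hrs hir hrk => ?_)
    obtain ⟨z, rfl⟩ := Fin.exists_succAbove_eq hr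
    obtain ⟨y, rfl⟩ := Fin.exists_succAbove_eq (show z ≠ s from fun h => hrs (h ▸ rfl))
    have hy := h4 y
    refine le_trans ?_ h2.le
    by_contra hlt
    rw [not_le] at hlt
    rcases hir.lt_or_eq with h | h
    · exact hy (Or.inr ⟨⟨h, hrk⟩, hlt⟩)
    · refine hy (Or.inl ⟨h.ge, ?_⟩)
      rwa [← h, hθ]

theorem slot_index_unique {m k l : ℕ} (hm : 0 < m) {t : ℝ} (hk : t ∈ slot m k)
    (hl : t ∈ slot m l) : k = l := by
  have hm' : (0 : ℝ) < m := by exact_mod_cast hm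
  have h1 := (div_lt_div_iff_of_pos_right hm').1 (hk.1.trans_le hl.2)
  have h2 := (div_lt_div_iff_of_pos_right hm').1 (hl.1.trans_le hk.2)
  have h3 : k < l + 1 := by exact_mod_cast (by linarith : (k : ℝ) < l + 1)
  have h4 : l < k + 1 := by exact_mod_cast (by linarith : (l : ℝ) < k + 1)
  omega

/-- The event determines its labels: `i` is the first item above its threshold, `k` is the slot of
its arrival, `none` or `some` records whether its value exceeds `v`, and `s` is the first item after
`i` above `τ k`. -/
theorem goodEvent_index_unique {m : ℕ} (hm : 0 < m) {τ : ℕ → ℝ} {v : ℝ} {n k k' : ℕ} (hk : 1 ≤ k)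
    (hk' : 1 ≤ k') {i i' : Fin (n + 2)} (hv : τ k ≤ v) (hv' : τ k' ≤ v)
    {o o' : Option (Fin (n + 1))} {ω : Fin (n + 2) → ℝ × ℝ} (h : ω ∈ goodEvent m τ v k i o)
    (h' : ω ∈ goodEvent m τ v k' i' o') : k = k' ∧ i = i' ∧ o = o' := by
  obtain ⟨h1, h2, h3⟩ := first_of_mem_goodEvent hv h
  obtain ⟨h1', h2', h3'⟩ := first_of_mem_goodEvent hv' h'
  have hii : i = i' := by
    by_contra hne
    rcases le_total (ω i).1 (ω i').1 with hle | hle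
    · exact h3' i hne ⟨hle, by rwa [stepThreshold_of_mem_slot hm hk τ h1]⟩
    · exact h3 i' (Ne.symm hne) ⟨hle, by rwa [stepThreshold_of_mem_slot hm hk' τ h1']⟩
  subst hii
  have hkk := slot_index_unique hm h1 h1'
  subst hkk
  refine ⟨rfl, rfl, ?_⟩
  have hlast : ∀ s s' : Fin (n + 1), s ≠ s' → ω ∈ goodSecond m τ v k i s →
      ω ∈ goodSecond m τ v k i s' → ¬ (ω (i.succAbove s)).1 ≤ (ω (i.succAbove s')).1 := by
    rintro s s' hne ⟨-, ⟨⟨ha, -⟩, hb⟩, -⟩ ⟨-, -, hc⟩ hle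
    obtain ⟨z, rfl⟩ := Fin.exists_succAbove_eq hne
    exact hc z (Or.inr ⟨⟨ha, hle⟩, hv.trans_lt hb⟩)
  cases o with
  | none =>
    cases o' with
    | none => rfl
    | some s' => exact absurd h'.1.2.2 (not_le.2 h.1.2)
  | some s =>
    cases o' with
    | none => exact absurd h.1.2.2 (not_le.2 h'.1.2)
    | some s' =>
      by_contra hne
      have hne' : s ≠ s' := fun e => hne (e ▸ rfl)
      rcases le_total (ω (i.succAbove s)).1 (ω (i.succAbove s')).1 with hle | hle
      · exact hlast s s' hne' h h' hle
      · exact hlast s' s hne'.symm h' h hle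

/-- At time `0` the threshold in force is the unconstrained `τ 0`; almost surely no item arrives
then. -/
theorem instanceLaw_ae_time_pos (μ : Measure ℝ) [IsProbabilityMeasure μ] (n : ℕ) :
    ∀ᵐ ω ∂(instanceLaw μ n), ∀ i, 0 < (ω i).1 := by
  have hm : MeasurableSet {x : ℝ × ℝ | x.1 ≤ 0} := measurableSet_le measurable_fst measurable_const
  have hpos : (instanceLaw μ n).real {ω | ∀ i, ω i ∈ {x : ℝ × ℝ | x.1 ≤ 0}ᶜ} = 1 := by
    rw [instanceLaw_eq, pi_real_forall_mem, probReal_compl_eq_one_sub hm,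
      itemLaw_real_time_nonpos]
    simp
  have hms : MeasurableSet {ω : Fin n → ℝ × ℝ | ∀ i, ω i ∈ {x : ℝ × ℝ | x.1 ≤ 0}ᶜ} :=
    measurableSet_setOfPred.2 (Measurable.forall fun i =>
      measurableSet_setOfPred.1 ((measurable_pi_apply i) hm.compl))
  have h1 : (instanceLaw μ n) {ω | ∀ i, ω i ∈ {x : ℝ × ℝ | x.1 ≤ 0}ᶜ} = 1 := by
    rw [← ofReal_measureReal, hpos, ENNReal.ofReal_one]
  have h2 := (prob_compl_eq_zero_iff hms).2 h1
  filter_upwards [compl_mem_ae_iff.2 h2] with ω hω i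
  simp only [compl_compl] at hω
  exact not_le.1 (hω i)

theorem lt_reward_of_early {m : ℕ} (hm : 0 < m) {τ : ℕ → ℝ} {v : ℝ} {n j : ℕ}
    (hj : ∀ k, 1 ≤ k → k < j → v < τ k) {ω : Fin n → ℝ × ℝ} (hpos : ∀ i, 0 < (ω i).1)
    (hex : ∃ i, ω i ∈ early (stepThreshold m τ) (((j : ℝ) - 1) / m)) :
    v < reward (stepThreshold m τ) ω := by
  have hm' : (0 : ℝ) < m := by exact_mod_cast hm
  refine lt_reward_of_exists_early _ ω (((j : ℝ) - 1) / m) v hex fun i hi hlt => ?_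
  refine lt_trans (hj ⌈(ω i).1 * m⌉₊ ?_ ?_) hlt
  · exact Nat.one_le_ceil_iff.2 (mul_pos (hpos i) hm')
  · have h1 := (le_div_iff₀ hm').1 hi
    have h2 := Nat.ceil_lt_add_one (mul_pos (hpos i) hm').le
    exact_mod_cast h2.trans_le (by linarith : (ω i).1 * m + 1 ≤ j)

theorem disjoint_early_goodEvent {m : ℕ} {τ : ℕ → ℝ} {v : ℝ} {n j k : ℕ} (hm : 0 < m) (hjk : j ≤ k)
    {i : Fin (n + 2)} (hv : τ k ≤ v) (o : Option (Fin (n + 1))) :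
    Disjoint {ω | ∃ i, ω i ∈ early (stepThreshold m τ) (((j : ℝ) - 1) / m)}
      (goodEvent m τ v k i o) := by
  rw [Set.disjoint_left]
  rintro ω ⟨r, hr⟩ hω
  obtain ⟨h1, h2, h3⟩ := first_of_mem_goodEvent hv hω
  have hm' : (0 : ℝ) < m := by exact_mod_cast hm
  have hjk' : (j : ℝ) ≤ k := by exact_mod_cast hjk
  have hle : ((j : ℝ) - 1) / m ≤ ((k : ℝ) - 1) / m := by gcongr
  have hlt : (ω r).1 < (ω i).1 := (hr.1.trans hle).trans_lt h1.1
  refine h3 r ?_ ⟨hlt.le, hr.2⟩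
  rintro rfl
  exact lt_irrefl _ hlt

/-- The events are disjoint, so their probabilities add up. The `n + 2` choices of `i` and the `n +
1` choices of `s` cancel the denominators left by the two integrations. -/
theorem reward_tail_lower_bound (μ : Measure ℝ) [IsProbabilityMeasure μ] {m : ℕ} (hm : 0 < m)
    (τ : ℕ → ℝ) {j : ℕ} (hj : 1 ≤ j) (hjm : j ≤ m + 1) {v : ℝ}
    (hlt : ∀ k, 1 ≤ k → k < j → v < τ k) (hge : ∀ k, j ≤ k → k ≤ m → τ k ≤ v)
    {p : ℕ → ℝ} (hp : p = fun r => μ.real (Set.Ioi (τ r)))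
    (hpos : ∀ k, 1 ≤ k → k ≤ m → 0 < p k) (n : ℕ) :
    1 - (1 - cum m p j) ^ (n + 2) + ∑ k ∈ Finset.Icc j m,
      (μ.real (Set.Ioi v) / p k *
          ((1 - cum m p k) ^ (n + 2) - (1 - cum m p (k + 1)) ^ (n + 2)) +
        (p k - μ.real (Set.Ioi v)) * (μ.real (Set.Ioi v) / p k) *
          (((1 - cum m p k) ^ (n + 2) - (1 - cum m p (k + 1)) ^ (n + 2)) / p k -
            (n + 2) * (1 / m) * (1 - cumRest m p k) ^ (n + 1))) ≤
      (instanceLaw μ (n + 2)).real {ω | v < reward (stepThreshold m τ) ω} := by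
  classical
  set q := μ.real (Set.Ioi v) with hq
  set P := instanceLaw μ (n + 2) with hP
  set E₀ : Set (Fin (n + 2) → ℝ × ℝ) :=
    {ω | ∃ i, ω i ∈ early (stepThreshold m τ) (((j : ℝ) - 1) / m)} with hE₀
  set I : Finset (ℕ × Fin (n + 2) × Option (Fin (n + 1))) :=
    Finset.Icc j m ×ˢ Finset.univ with hI
  set G : ℕ × Fin (n + 2) × Option (Fin (n + 1)) → Set (Fin (n + 2) → ℝ × ℝ) :=
    fun x => goodEvent m τ v x.1 x.2.1 x.2.2 with hG
  have hmem : ∀ x ∈ I, j ≤ x.1 ∧ x.1 ≤ m := fun x hx => by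
    simpa [hI] using hx
  have hU : P.real (⋃ x ∈ I, G x) = ∑ x ∈ I, P.real (G x) := by
    refine measureReal_biUnion_finset ?_ fun x _ => measurableSet_goodEvent _ _ _ _ _ _
    intro x hx y hy hxy
    have hx' := hmem x hx
    have hy' := hmem y hy
    refine Set.disjoint_left.2 fun ω h h' => hxy ?_
    obtain ⟨h1, h2, h3⟩ := goodEvent_index_unique hm (hj.trans hx'.1) (hj.trans hy'.1)
      (hge _ hx'.1 hx'.2) (hge _ hy'.1 hy'.2) h h'
    exact Prod.ext h1 (Prod.ext h2 h3)
  have hUm : MeasurableSet (⋃ x ∈ I, G x) :=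
    Finset.measurableSet_biUnion I fun x _ => measurableSet_goodEvent _ _ _ _ _ _
  have hdisj : Disjoint E₀ (⋃ x ∈ I, G x) := by
    simp only [Set.disjoint_iUnion_right]
    intro x hx
    exact disjoint_early_goodEvent hm (hmem x hx).1 (hge _ (hmem x hx).1 (hmem x hx).2) _
  have hsub : P.real (E₀ ∪ ⋃ x ∈ I, G x) ≤ P.real {ω | v < reward (stepThreshold m τ) ω} := by
    refine ENNReal.toReal_mono (measure_ne_top _ _) (measure_mono_ae ?_)
    filter_upwards [instanceLaw_ae_time_pos μ (n + 2)] with ω hω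
    rintro (h | h)
    · exact lt_reward_of_early hm hlt hω h
    · simp only [Set.mem_iUnion] at h
      obtain ⟨x, hx, h⟩ := h
      exact goodEvent_subset hm (hj.trans (hmem x hx).1) (hge _ (hmem x hx).1 (hmem x hx).2) _ h
  refine le_trans ?_ hsub
  rw [measureReal_union hdisj hUm (measure_ne_top P _) (measure_ne_top P _), hU, hP, instanceLaw_real_exists_early μ hm τ hj hjm, ← hp, hI,
    Finset.sum_product]
  refine add_le_add le_rfl (Finset.sum_le_sum fun k hk => ?_)
  rw [Finset.mem_Icc] at hk
  have hk1 : 1 ≤ k := hj.trans hk.1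
  have hpk := hpos k hk1 hk.2
  have hpk' : 0 < μ.real (Set.Ioi (τ k)) := by rw [hp] at hpk; exact hpk
  have hpkeq : μ.real (Set.Ioi (τ k)) = p k := by rw [hp]
  rw [Fintype.sum_prod_type]
  simp only [hG, Fintype.sum_option, goodEvent]
  set D := (1 - cum m p k) ^ (n + 2) - (1 - cum m p (k + 1)) ^ (n + 2) with hD
  have hfirst : ∀ i : Fin (n + 2), (instanceLaw μ (n + 2)).real (goodFirst m τ v k i) =
      q * (D / ((n + 2) * p k)) := by
    intro i
    rw [instanceLaw_real_goodFirst μ τ hm hk1 hk.2 hpk' v i, ← hp, hpkeq, hD, hq]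
    push_cast
    ring
  have hsecond : ∀ (i : Fin (n + 2)) (s : Fin (n + 1)),
      (p k - q) * (q / ((n + 1) * p k) * (D / ((n + 2) * p k) -
        (1 - cumRest m p k) ^ (n + 1) * (1 / m))) ≤
      (instanceLaw μ (n + 2)).real (goodSecond m τ v k i s) := by
    intro i s
    have := instanceLaw_real_goodSecond μ τ hm hk1 hk.2 hpk' (hge k hk.1 hk.2) i s
    rwa [← hp, hpkeq] at this
  have hsum : ∑ _i : Fin (n + 2), (q * (D / ((n + 2) * p k)) + ∑ _s : Fin (n + 1),
      (p k - q) * (q / ((n + 1) * p k) * (D / ((n + 2) * p k) -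
        (1 - cumRest m p k) ^ (n + 1) * (1 / m)))) ≤
      ∑ i : Fin (n + 2), ((instanceLaw μ (n + 2)).real (goodFirst m τ v k i) +
        ∑ s : Fin (n + 1), (instanceLaw μ (n + 2)).real (goodSecond m τ v k i s)) :=
    Finset.sum_le_sum fun i _ => add_le_add (hfirst i).ge
      (Finset.sum_le_sum fun s _ => hsecond i s)
  refine le_trans (le_of_eq ?_) hsum
  simp only [Finset.sum_const, Finset.card_univ, Fintype.card_fin, nsmul_eq_mul]
  have h1 : (n : ℝ) + 1 ≠ 0 := by positivity
  have h2 : (n : ℝ) + 2 ≠ 0 := by positivity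
  push_cast
  generalize (1 - cumRest m p k) ^ (n + 1) = z
  field_simp

/-! ### Passage to the limit -/

open Filter Topology in
theorem tendsto_one_sub_div_pow (a : ℝ) :
    Tendsto (fun n : ℕ => (1 - a / ((n : ℝ) + 2)) ^ (n + 2)) atTop (𝓝 (Real.exp (-a))) := by
  have h := (tendsto_add_atTop_iff_nat 2).2 (Real.tendsto_one_add_div_pow_exp (-a))
  refine h.congr fun n => ?_
  push_cast
  rw [neg_div, sub_eq_add_neg]

-- The exponent is one short of the denominator; the missing factor tends to `1`.
open Filter Topology in
theorem tendsto_one_sub_div_pow_pred (a : ℝ) :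
    Tendsto (fun n : ℕ => (1 - a / ((n : ℝ) + 2)) ^ (n + 1)) atTop (𝓝 (Real.exp (-a))) := by
  have h1 : Tendsto (fun n : ℕ => 1 - a / ((n : ℝ) + 2)) atTop (𝓝 1) := by
    have h : Tendsto (fun n : ℕ => a / ((n : ℝ) + 2)) atTop (𝓝 0) := by
      have := (tendsto_add_atTop_iff_nat 2).2 (tendsto_const_div_atTop_nhds_zero_nat a)
      exact this.congr fun n => by push_cast; rfl
    simpa using h.const_sub 1
  have h2 := (tendsto_one_sub_div_pow a).div h1 one_ne_zero
  rw [div_one] at h2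
  refine h2.congr' ?_
  filter_upwards [h1.eventually_ne one_ne_zero] with n hn
  rw [Pi.div_apply, pow_succ _ (n + 1), mul_div_assoc, div_self hn, mul_one]

theorem cum_div (m : ℕ) (c : ℕ → ℝ) (N : ℝ) (k : ℕ) :
    cum m (fun r => c r / N) k = cum m c k / N := by
  rw [cum, cum, ← Finset.sum_div, mul_div_assoc]

/-- The form in which `f` appears as the limit of the tail bound: the coefficient `l * (2 * c k - l)
/ c k ^ 2` collects `l / c k` from an immediate good acceptance and `(c k - l) * l / c k ^ 2` from a
second one. -/
theorem f_eq {m : ℕ} (hm : 0 < m) {c : ℕ → ℝ} {j : ℕ} (hj : 1 ≤ j)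
    (hc : ∀ k, 1 ≤ k → k ≤ m → 0 < c k) (l : ℝ) :
    f m c j l = 1 - Real.exp (-cum m c j) + ∑ k ∈ Finset.Icc j m,
      (l * (2 * c k - l) / c k ^ 2 * (Real.exp (-cum m c k) - Real.exp (-cum m c (k + 1))) -
        l * (c k - l) / (c k * m) * Real.exp (-cumRest m c k)) := by
  unfold f
  congr 1
  refine Finset.sum_congr rfl fun k hk => ?_
  rw [Finset.mem_Icc] at hk
  have hck := hc k (hj.trans hk.1) hk.2
  have hm' : (0 : ℝ) < m := by exact_mod_cast hm
  have e1 : Real.exp (-cum m c (k + 1)) = Real.exp (-cum m c k) * Real.exp (-(c k / m)) := by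
    rw [cum_succ _ _ (hj.trans hk.1), ← Real.exp_add]; congr 1; ring
  have e2 : Real.exp (-cumRest m c k) = Real.exp (-cum m c k) *
      (Real.exp (-(((m : ℝ) + 1) * c k / m)) * Real.exp ((k : ℝ) * c k / m)) := by
    rw [cumRest, ← Real.exp_add, ← Real.exp_add]; congr 1; field_simp; ring
  have e3 : Real.exp (-(((m : ℝ) + 1) * c k / m)) * Real.exp (c k) * Real.exp (c k / m) = 1 := by
    rw [← Real.exp_add, ← Real.exp_add, Real.exp_eq_one_iff]; field_simp; ring
  have e4 : Real.exp (-(((m : ℝ) + 1) * c k / m)) * Real.exp (c k) = Real.exp (-(c k / m)) := by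
    rw [← Real.exp_add]; congr 1; field_simp; ring
  rw [e1, e2, ← e4]
  change Real.exp (-cum m c k) * _ = _
  generalize Real.exp (-(((m : ℝ) + 1) * c k / m)) = x at *
  generalize Real.exp (c k / m) = y at *
  generalize Real.exp (c k) = z at *
  have e5 : x * z * (y - 1) = 1 - x * z := by rw [mul_sub, e3, mul_one]
  rw [← mul_one_sub, ← e5]
  field_simp
  ring

/-- Each summand is nonnegative: with `x = c k / m`, the loss is at most `l / c k * x * e^{-x}` and
the gain at least `l / c k * (1 - e^{-x})`, up to the same factor, and `x * e^{-x} ≤ 1 - e^{-x}`.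
This makes the infima in `ratioBound` genuine and settles the case `l = 0`. -/
theorem f_nonneg {m : ℕ} (hm : 0 < m) {c : ℕ → ℝ} {j : ℕ} (hj : 1 ≤ j)
    (hc : ∀ k, 1 ≤ k → k ≤ m → 0 < c k) {l : ℝ} (hl : 0 ≤ l) (hlc : ∀ k, j ≤ k → k ≤ m → l ≤ c k)
    (hcum : 0 ≤ cum m c j) : 0 ≤ f m c j l := by
  rw [f_eq hm hj hc]
  have h1 : Real.exp (-cum m c j) ≤ 1 := Real.exp_le_one_iff.2 (by linarith)
  refine add_nonneg (by linarith) (Finset.sum_nonneg fun k hk => ?_)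
  rw [Finset.mem_Icc] at hk
  have hck := hc k (hj.trans hk.1) hk.2
  have hlk := hlc k hk.1 hk.2
  have hm' : (0 : ℝ) < m := by exact_mod_cast hm
  have hkm : (k : ℝ) ≤ m := by exact_mod_cast hk.2
  have hE := Real.exp_pos (-cum m c k)
  set x := c k / m with hx
  have hx0 : 0 < x := by positivity
  have e1 : Real.exp (-cum m c (k + 1)) = Real.exp (-cum m c k) * Real.exp (-x) := by
    rw [cum_succ _ _ (hj.trans hk.1), ← Real.exp_add]; congr 1; rw [hx]; ring
  have e2 : Real.exp (-cumRest m c k) ≤ Real.exp (-cum m c k) * Real.exp (-x) := by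
    rw [cumRest, ← Real.exp_add]
    refine Real.exp_le_exp.2 ?_
    have : c k * (1 - ((k : ℝ) - 1) / m) - x = c k * (m - k) / m := by
      rw [hx]; field_simp; ring
    have h0 : 0 ≤ c k * (m - k) / m :=
      div_nonneg (mul_nonneg hck.le (by linarith)) hm'.le
    linarith
  have e3 : x * Real.exp (-x) ≤ 1 - Real.exp (-x) := by
    have h := Real.add_one_le_exp x
    have h2 : Real.exp x * Real.exp (-x) = 1 := by rw [← Real.exp_add]; simp
    have := mul_le_mul_of_nonneg_right h (Real.exp_pos (-x)).le
    linarith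
  have hu : l / c k ≤ l * (2 * c k - l) / c k ^ 2 := by
    rw [div_le_div_iff₀ hck (by positivity)]
    nlinarith [mul_nonneg (mul_nonneg hl hck.le) (sub_nonneg.2 hlk)]
  have hw : l * (c k - l) / (c k * m) ≤ l / c k * x := by
    rw [hx, div_mul_div_comm]
    gcongr
    linarith
  have hw0 : 0 ≤ l / c k := by positivity
  have ha : l * (c k - l) / (c k * m) * Real.exp (-cumRest m c k) ≤
      l / c k * x * (Real.exp (-cum m c k) * Real.exp (-x)) := by
    gcongr
  have hb : l / c k * (Real.exp (-cum m c k) * (1 - Real.exp (-x))) ≤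
      l * (2 * c k - l) / c k ^ 2 * (Real.exp (-cum m c k) - Real.exp (-cum m c (k + 1))) := by
    rw [e1, ← mul_one_sub]
    have : 0 ≤ 1 - Real.exp (-x) := by
      linarith [mul_pos hx0 (Real.exp_pos (-x))]
    gcongr
  have hc' : l / c k * x * (Real.exp (-cum m c k) * Real.exp (-x)) ≤
      l / c k * (Real.exp (-cum m c k) * (1 - Real.exp (-x))) := by
    rw [mul_assoc, mul_left_comm x]
    gcongr
  linarith

/-- The lower bound on the tail probability with `n + 2` items, as a function of the expected
number `l` of items above the given value. -/
def finiteF (m : ℕ) (c : ℕ → ℝ) (n j : ℕ) (l : ℝ) : ℝ :=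
  1 - (1 - cum m c j / ((n : ℝ) + 2)) ^ (n + 2) + ∑ k ∈ Finset.Icc j m,
    (l * (2 * c k - l) / c k ^ 2 * ((1 - cum m c k / ((n : ℝ) + 2)) ^ (n + 2) -
        (1 - cum m c (k + 1) / ((n : ℝ) + 2)) ^ (n + 2)) -
      l * (c k - l) / (c k * m) * (1 - cumRest m c k / ((n : ℝ) + 2)) ^ (n + 1))

theorem one_sub_exp_le {a N : ℝ} {n : ℕ} (hN : N = n + 2) (ha : a ≤ N) :
    1 - Real.exp (-a) ≤ 1 - (1 - a / N) ^ (n + 2) := by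
  subst hN
  have := Real.one_sub_div_pow_le_exp_neg (n := n + 2) (t := a) (by push_cast; exact ha)
  push_cast at this
  linarith

-- The error is proportional to `l`: both coefficients in a summand are `l` times a bounded
-- quantity, and the term outside the sum errs only in the favourable direction, by
-- `one_sub_exp_le`.
open Filter Topology in
theorem eventually_f_sub_le_finiteF {m : ℕ} (hm : 0 < m) {c : ℕ → ℝ}
    (hc : ∀ k, 1 ≤ k → k ≤ m → 0 < c k) {δ : ℝ} (hδ : 0 < δ) :
    ∀ᶠ n : ℕ in atTop, ∀ j, 1 ≤ j → j ≤ m → ∀ l, 0 ≤ l → (∀ k, j ≤ k → k ≤ m → l ≤ c k) →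
      f m c j l - δ * l ≤ finiteF m c n j l := by
  set DN : ℕ → ℕ → ℝ := fun k n => (1 - cum m c k / ((n : ℝ) + 2)) ^ (n + 2) -
        (1 - cum m c (k + 1) / ((n : ℝ) + 2)) ^ (n + 2) with hDN
  set D : ℕ → ℝ := fun k => Real.exp (-cum m c k) - Real.exp (-cum m c (k + 1)) with hD
  set zN : ℕ → ℕ → ℝ := fun k n => (1 - cumRest m c k / ((n : ℝ) + 2)) ^ (n + 1) with hzN
  set z : ℕ → ℝ := fun k => Real.exp (-cumRest m c k) with hz
  have hm' : (0 : ℝ) < m := by exact_mod_cast hm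
  have hlim : Tendsto (fun n => ∑ k ∈ Finset.Icc 1 m,
      (2 / c k * |DN k n - D k| + 1 / m * |zN k n - z k|)) atTop (𝓝 0) := by
    have h : ∀ k ∈ Finset.Icc 1 m, Tendsto
        (fun n => 2 / c k * |DN k n - D k| + 1 / m * |zN k n - z k|) atTop (𝓝 0) := by
      intro k _
      have h1 : Tendsto (DN k) atTop (𝓝 (D k)) :=
        (tendsto_one_sub_div_pow _).sub (tendsto_one_sub_div_pow _)
      have h2 : Tendsto (zN k) atTop (𝓝 (z k)) := tendsto_one_sub_div_pow_pred _
      have h3 : Tendsto (fun n => |DN k n - D k|) atTop (𝓝 0) := by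
        simpa using (h1.sub_const (D k)).abs
      have h4 : Tendsto (fun n => |zN k n - z k|) atTop (𝓝 0) := by
        simpa using (h2.sub_const (z k)).abs
      simpa using (h3.const_mul (2 / c k)).add (h4.const_mul (1 / (m : ℝ)))
    simpa using tendsto_finsetSum _ h
  have hbig : ∀ᶠ n : ℕ in atTop, ∀ k ∈ Finset.range (m + 1), cum m c k ≤ (n : ℝ) + 2 := by
    rw [Finset.eventually_all]
    intro k _
    filter_upwards [tendsto_natCast_atTop_atTop.eventually_ge_atTop (cum m c k)] with n hn
    linarith
  filter_upwards [hlim.eventually_lt_const hδ, hbig] with n hn hcumn j hj hjm l hl hlc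
  rw [f_eq hm hj hc, finiteF]
  have h0 := one_sub_exp_le (n := n) rfl (hcumn j (Finset.mem_range.2 (by omega)))
  have hterm : ∀ k ∈ Finset.Icc j m,
      l * (2 * c k - l) / c k ^ 2 * D k - l * (c k - l) / (c k * m) * z k -
        l * (2 / c k * |DN k n - D k| + 1 / m * |zN k n - z k|) ≤
      l * (2 * c k - l) / c k ^ 2 * DN k n - l * (c k - l) / (c k * m) * zN k n := by
    intro k hk
    rw [Finset.mem_Icc] at hk
    have hck := hc k (hj.trans hk.1) hk.2
    have hlk := hlc k hk.1 hk.2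
    have hu0 : 0 ≤ l * (2 * c k - l) / c k ^ 2 :=
      div_nonneg (mul_nonneg hl (by linarith)) (by positivity)
    have hu : l * (2 * c k - l) / c k ^ 2 ≤ l * (2 / c k) := by
      rw [mul_div_assoc' l, div_le_div_iff₀ (by positivity) hck]
      nlinarith [mul_nonneg (mul_nonneg hl hl) hck.le]
    have hw0 : 0 ≤ l * (c k - l) / (c k * m) :=
      div_nonneg (mul_nonneg hl (by linarith)) (by positivity)
    have hw : l * (c k - l) / (c k * m) ≤ l * (1 / m) := by
      rw [mul_div_assoc' l, div_le_div_iff₀ (by positivity) hm']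
      nlinarith [mul_nonneg (mul_nonneg hl hl) hm'.le]
    have a1 : -(l * (2 / c k) * |DN k n - D k|) ≤
        l * (2 * c k - l) / c k ^ 2 * (DN k n - D k) := by
      have b1 := mul_le_mul_of_nonneg_left (neg_abs_le (DN k n - D k)) hu0
      have b2 := mul_le_mul_of_nonneg_right hu (abs_nonneg (DN k n - D k))
      linarith
    have a2 : l * (c k - l) / (c k * m) * (zN k n - z k) ≤ l * (1 / m) * |zN k n - z k| := by
      have b1 := mul_le_mul_of_nonneg_left (le_abs_self (zN k n - z k)) hw0
      have b2 := mul_le_mul_of_nonneg_right hw (abs_nonneg (zN k n - z k))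
      linarith
    linarith
  have hsum := Finset.sum_le_sum hterm
  rw [Finset.sum_sub_distrib, ← Finset.mul_sum] at hsum
  have herr : ∑ k ∈ Finset.Icc j m, (2 / c k * |DN k n - D k| + 1 / m * |zN k n - z k|) ≤
      ∑ k ∈ Finset.Icc 1 m, (2 / c k * |DN k n - D k| + 1 / m * |zN k n - z k|) := by
    refine Finset.sum_le_sum_of_subset_of_nonneg (Finset.Icc_subset_Icc_left hj) fun k hk _ => ?_
    rw [Finset.mem_Icc] at hk
    have := hc k hk.1 hk.2
    positivity
  have := mul_le_mul_of_nonneg_left (herr.trans hn.le) hl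
  linarith

/-- With `x = l / N`, replacing the `N` factors `e^{-x}` by `1 - x` one at a time costs at most `x ^
2` each. -/
theorem exp_neg_sub_pow_le {l N : ℝ} {n : ℕ} (hN : N = n + 2) (hl : 0 ≤ l) (hlN : l ≤ N) :
    Real.exp (-l) - (1 - l / N) ^ (n + 2) ≤ l ^ 2 / N := by
  have hN0 : 0 < N := by rw [hN]; positivity
  set x := l / N with hx
  have hx0 : 0 ≤ x := by positivity
  have hx1 : x ≤ 1 := (div_le_one hN0).2 hlN
  have he : Real.exp (-l) = Real.exp (-x) ^ (n + 2) := by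
    rw [← Real.exp_nat_mul]; congr 1; push_cast; rw [← hN, hx]; field_simp
  have h1 : Real.exp (-x) ≤ 1 - x + x ^ 2 := by
    have := Real.abs_exp_sub_one_sub_id_le (x := -x) (by rw [abs_neg, abs_of_nonneg hx0]; exact hx1)
    have := (abs_le.1 this).2
    nlinarith
  have hle : 1 - x ≤ Real.exp (-x) := by linarith [Real.add_one_le_exp (-x)]
  have hstep : ∀ k : ℕ, Real.exp (-x) ^ k - (1 - x) ^ k ≤ k * x ^ 2 := by
    intro k
    induction k with
    | zero => simp
    | succ k ih =>
      have e : Real.exp (-x) ^ (k + 1) - (1 - x) ^ (k + 1) =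
        Real.exp (-x) * (Real.exp (-x) ^ k - (1 - x) ^ k) +
          (Real.exp (-x) - (1 - x)) * (1 - x) ^ k := by ring
      have h2 : Real.exp (-x) ≤ 1 := Real.exp_le_one_iff.2 (by linarith)
      have h3 : (1 - x) ^ k ≤ 1 := pow_le_one₀ (by linarith) (by linarith)
      have h4 : 0 ≤ Real.exp (-x) ^ k - (1 - x) ^ k :=
        sub_nonneg.2 (pow_le_pow_left₀ (by linarith) hle k)
      have h5 : Real.exp (-x) * (Real.exp (-x) ^ k - (1 - x) ^ k) ≤
        Real.exp (-x) ^ k - (1 - x) ^ k := mul_le_of_le_one_left h4 h2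
      have h6 : (Real.exp (-x) - (1 - x)) * (1 - x) ^ k ≤ Real.exp (-x) - (1 - x) :=
        mul_le_of_le_one_right (by linarith) h3
      push_cast
      linarith
  have := hstep (n + 2)
  rw [he]
  refine this.trans (le_of_eq ?_)
  push_cast
  rw [← hN, hx]
  field_simp

/-! ### The competitive ratio -/

theorem lt_prophet_iff {n : ℕ} (ω : Fin (n + 1) → ℝ × ℝ) (v : ℝ) :
    v < prophet ω ↔ ∃ i, v < (ω i).2 :=
  lt_ciSup_iff (Set.finite_range _).bddAbove

theorem measurable_prophet (n : ℕ) : Measurable (prophet (n := n)) :=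
  Measurable.iSup fun i => (measurable_pi_apply i).snd

theorem itemLaw_real_value_le (μ : Measure ℝ) [IsProbabilityMeasure μ] (v : ℝ) :
    (itemLaw μ).real {x | x.2 ≤ v} = 1 - μ.real (Set.Ioi v) := by
  have h : {x : ℝ × ℝ | x.2 ≤ v} = Set.univ ×ˢ (Set.Ioi v)ᶜ := by ext; simp
  rw [h, itemLaw, measureReal_prod_prod, probReal_compl_eq_one_sub measurableSet_Ioi]
  simp

theorem instanceLaw_real_lt_prophet (μ : Measure ℝ) [IsProbabilityMeasure μ] (n : ℕ) (v : ℝ) :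
    (instanceLaw μ (n + 1)).real {ω | v < prophet ω} = 1 - (1 - μ.real (Set.Ioi v)) ^ (n + 1) := by
  have hc : {ω : Fin (n + 1) → ℝ × ℝ | v < prophet ω} =
      {ω | ∀ i, ω i ∈ {x : ℝ × ℝ | x.2 ≤ v}}ᶜ := by
    ext ω
    simp [lt_prophet_iff]
  have hms : MeasurableSet {ω : Fin (n + 1) → ℝ × ℝ | ∀ i, ω i ∈ {x : ℝ × ℝ | x.2 ≤ v}} :=
    measurableSet_setOfPred.2 (Measurable.forall fun i => measurableSet_setOfPred.1
      ((measurable_pi_apply i) (measurableSet_le measurable_snd measurable_const)))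
  rw [hc, probReal_compl_eq_one_sub hms, instanceLaw_eq, pi_real_forall_mem,
    itemLaw_real_value_le]

theorem reward_nonneg {n : ℕ} (θ : ℝ → ℝ) (ω : Fin n → ℝ × ℝ) : 0 ≤ reward θ ω := by
  unfold reward
  induction accepted θ (arrivals ω) with
  | nil => simp
  | cons a L ih => exact le_max_of_le_right ih

/-- A comparison of tails implies the comparison of expectations. -/
theorem lintegral_prophet_le_of_tail (μ : Measure ℝ) [IsProbabilityMeasure μ] {n : ℕ} {θ : ℝ → ℝ}
    (hθ : Measurable θ) {α : ℝ} (hα : 0 ≤ α)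
    (h : ∀ v, 0 < v → α * (instanceLaw μ n).real {ω | v < prophet ω} ≤
      (instanceLaw μ n).real {ω | v < reward θ ω}) :
    ENNReal.ofReal α * ∫⁻ ω, ENNReal.ofReal (prophet ω) ∂(instanceLaw μ n) ≤
      ∫⁻ ω, ENNReal.ofReal (reward θ ω) ∂(instanceLaw μ n) := by
  -- The layer-cake formula wants a nonnegative function; truncation at `0` changes neither the
  -- integral nor the level sets for `v > 0`.
  have h1 : ∫⁻ ω, ENNReal.ofReal (prophet ω) ∂(instanceLaw μ n) =
      ∫⁻ ω, ENNReal.ofReal (max (prophet ω) 0) ∂(instanceLaw μ n) := by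
    refine lintegral_congr fun ω => ?_
    rcases le_total 0 (prophet ω) with h0 | h0
    · rw [max_eq_left h0]
    · rw [max_eq_right h0, ENNReal.ofReal_of_nonpos h0, ENNReal.ofReal_zero]
  rw [h1, lintegral_eq_lintegral_meas_lt _
      (f := fun ω : Fin n → ℝ × ℝ => max (prophet ω) 0)
      (Filter.Eventually.of_forall fun ω => le_max_right (prophet ω) 0)
      ((measurable_prophet n).max measurable_const).aemeasurable,
    lintegral_eq_lintegral_meas_lt _ (Filter.Eventually.of_forall fun ω => reward_nonneg θ ω)
      (measurable_reward hθ).aemeasurable,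
    ← lintegral_const_mul' _ _ ENNReal.ofReal_ne_top]
  refine setLIntegral_mono' measurableSet_Ioi fun v hv => ?_
  have hset : {ω : Fin n → ℝ × ℝ | v < max (prophet ω) 0} = {ω | v < prophet ω} := by
    ext ω
    simp [not_lt.2 (le_of_lt (Set.mem_Ioi.1 hv))]
  rw [hset, ← ofReal_measureReal, ← ofReal_measureReal, ← ENNReal.ofReal_mul hα]
  exact ENNReal.ofReal_le_ofReal (h v hv)

theorem le_of_increasing {m : ℕ} {c : ℕ → ℝ} (hc : ∀ i < m, c i < c (i + 1)) {i k : ℕ}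
    (hik : i ≤ k) (hkm : k ≤ m) : c i ≤ c k := by
  induction k, hik using Nat.le_induction with
  | base => rfl
  | succ k hk ih => exact (ih (by omega)).trans (hc k (by omega)).le

theorem lt_of_increasing {m : ℕ} {c : ℕ → ℝ} (hc : ∀ i < m, c i < c (i + 1)) {i k : ℕ}
    (hik : i < k) (hkm : k ≤ m) : c i < c k :=
  (hc i (by omega)).trans_le (le_of_increasing hc hik hkm)

theorem cum_nonneg {m : ℕ} {c : ℕ → ℝ} (hc : ∀ k, 1 ≤ k → k ≤ m → 0 < c k) {j : ℕ}
    (hj : j ≤ m + 1) : 0 ≤ cum m c j := by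
  refine mul_nonneg (by positivity) (Finset.sum_nonneg fun r hr => ?_)
  rw [Finset.mem_Ico] at hr
  exact (hc r hr.1 (by omega)).le

theorem ratioBound_le_one_sub (m : ℕ) (c : ℕ → ℝ) :
    ratioBound m c ≤ 1 - Real.exp (-cum m c (m + 1)) := by
  refine (min_le_left _ _).trans (le_of_eq ?_)
  rw [cum]
  rfl

theorem ratioBound_mul_le_f {m : ℕ} (hm : 0 < m) {c : ℕ → ℝ} (hc0 : c 0 = 0)
    (hc : ∀ i < m, c i < c (i + 1)) {j : ℕ} (hj : j < m) {l : ℝ} (hl0 : 0 < l)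
    (hl : l ∈ Set.Icc (c j) (c (j + 1))) :
    ratioBound m c * (1 - Real.exp (-l)) ≤ f m c (j + 1) l := by
  have hpos : ∀ k, 1 ≤ k → k ≤ m → 0 < c k := fun k hk hkm =>
    hc0 ▸ lt_of_increasing hc (by omega) hkm
  have hexp : ∀ x : ℝ, 0 < x → 0 < 1 - Real.exp (-x) := fun x hx => by
    have := Real.exp_lt_one_iff.2 (neg_neg_of_pos hx)
    linarith
  have hbdd : BddBelow ((fun l => f m c (j + 1) l / (1 - Real.exp (-l))) ''
      {l | l ∈ Set.Icc (c j) (c (j + 1)) ∧ 0 < l}) := by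
    refine ⟨0, ?_⟩
    rintro _ ⟨x, ⟨hx, hx0⟩, rfl⟩
    refine div_nonneg (f_nonneg hm (by omega) hpos hx0.le (fun k hk hkm =>
      hx.2.trans (le_of_increasing hc hk hkm)) (cum_nonneg hpos (by omega))) (hexp x hx0).le
  have h1 : ratioBound m c ≤ f m c (j + 1) l / (1 - Real.exp (-l)) := by
    refine (min_le_right _ _).trans ((ciInf_le (Set.finite_range _).bddBelow ⟨j, hj⟩).trans ?_)
    exact csInf_le hbdd ⟨l, ⟨hl, hl0⟩, rfl⟩
  exact (le_div_iff₀ (hexp l hl0)).1 h1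

theorem finiteF_le_tail (μ : Measure ℝ) [IsProbabilityMeasure μ] {m : ℕ} (hm : 0 < m) {c τ : ℕ → ℝ}
    (hc : ∀ k, 1 ≤ k → k ≤ m → 0 < c k) {n : ℕ}
    (hτ : ∀ k, 1 ≤ k → k ≤ m → ((n : ℝ) + 2) * μ.real (Set.Ioi (τ k)) = c k)
    {j : ℕ} (hj : 1 ≤ j) (hjm : j ≤ m + 1) {v : ℝ}
    (hlt : ∀ k, 1 ≤ k → k < j → v < τ k) (hge : ∀ k, j ≤ k → k ≤ m → τ k ≤ v) :
    finiteF m c n j (((n : ℝ) + 2) * μ.real (Set.Ioi v)) ≤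
      (instanceLaw μ (n + 2)).real {ω | v < reward (stepThreshold m τ) ω} := by
  have hN : (0 : ℝ) < (n : ℝ) + 2 := by positivity
  set p : ℕ → ℝ := fun r => μ.real (Set.Ioi (τ r)) with hp
  have hpc : ∀ k, 1 ≤ k → k ≤ m → p k = c k / ((n : ℝ) + 2) := fun k hk hkm => by
    rw [eq_div_iff hN.ne', mul_comm]; exact hτ k hk hkm
  have hcum : ∀ k, k ≤ m + 1 → cum m p k = cum m c k / ((n : ℝ) + 2) := fun k hk => by
    rw [← cum_div, cum, cum]
    congr 1
    refine Finset.sum_congr rfl fun r hr => ?_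
    rw [Finset.mem_Ico] at hr
    exact hpc r hr.1 (by omega)
  have hrest : ∀ k, 1 ≤ k → k ≤ m → cumRest m p k = cumRest m c k / ((n : ℝ) + 2) :=
    fun k hk hkm => by
    rw [cumRest, cumRest, hcum k (by omega), hpc k hk hkm]; ring
  refine le_trans (le_of_eq ?_) (reward_tail_lower_bound μ hm τ hj hjm hlt hge hp
    (fun k hk hkm => by rw [hpc k hk hkm]; exact div_pos (hc k hk hkm) hN) n)
  rw [finiteF, hcum j hjm]
  congr 1
  refine Finset.sum_congr rfl fun k hk => ?_
  rw [Finset.mem_Icc] at hk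
  have hk1 := hj.trans hk.1
  have hck := hc k hk1 hk.2
  rw [hcum k (by omega), hcum (k + 1) (by omega), hrest k hk1 hk.2, hpc k hk1 hk.2]
  generalize (1 - cumRest m c k / ((n : ℝ) + 2)) ^ (n + 1) = z
  generalize (1 - cum m c k / ((n : ℝ) + 2)) ^ (n + 2) -
    (1 - cum m c (k + 1) / ((n : ℝ) + 2)) ^ (n + 2) = D
  have hm' : (0 : ℝ) < m := by exact_mod_cast hm
  field_simp
  ring

/-- The thresholds determine the slot from which on they lie below `v`. -/
theorem exists_threshold_index {m : ℕ} {τ : ℕ → ℝ}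
    (hτ : ∀ i k, 1 ≤ i → i < k → k ≤ m → τ k < τ i) (v : ℝ) :
    ∃ j, 1 ≤ j ∧ j ≤ m + 1 ∧ (∀ k, 1 ≤ k → k < j → v < τ k) ∧
      ∀ k, j ≤ k → k ≤ m → τ k ≤ v := by
  classical
  -- The value `m + 1` is the default when every threshold exceeds `v`.
  have hex : ∃ j, 1 ≤ j ∧ (j = m + 1 ∨ τ j ≤ v) := ⟨m + 1, by omega, Or.inl rfl⟩
  refine ⟨Nat.find hex, (Nat.find_spec hex).1,
    Nat.find_min' hex ⟨by omega, Or.inl rfl⟩, fun k hk hkj => ?_, fun k hjk hkm => ?_⟩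
  · have := Nat.find_min hex hkj
    push Not at this
    exact (this hk).2
  · obtain ⟨h1, h2⟩ := Nat.find_spec hex
    rcases h2 with h2 | h2
    · omega
    · rcases hjk.lt_or_eq with h | h
      · exact (hτ _ _ h1 h hkm).le.trans h2
      · rwa [← h]

-- On `[0, c m]` one has `1 - e^{-l} ≥ κ * l` with `κ = 1 / (1 + c m)`, so giving up `ε` in the
-- ratio pays for an error `ε * κ * l`. Half of it covers the passage from `finiteF` to `f`, half
-- the passage from `1 - (1 - q) ^ N` to `1 - e^{-l}`.
open Filter Topology in
theorem eventually_isCompetitive {m : ℕ} (hm : 0 < m) {c : ℕ → ℝ} (hc0 : c 0 = 0)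
    (hc : ∀ i < m, c i < c (i + 1)) {ε : ℝ} (hε : 0 < ε) :
    ∀ᶠ n : ℕ in atTop, IsCompetitive m c (n + 2) (ratioBound m c - ε) := by
  have hpos : ∀ k, 1 ≤ k → k ≤ m → 0 < c k := fun k hk hkm =>
    hc0 ▸ lt_of_increasing hc (by omega) hkm
  set ρ := ratioBound m c with hρ
  have hcm := hpos m hm le_rfl
  set κ : ℝ := 1 / (1 + c m) with hκ
  have hκ0 : 0 < κ := by positivity
  have hδ : 0 < ε * κ / 2 := by positivity
  have hρ1 : ρ ≤ 1 - Real.exp (-cum m c (m + 1)) := ratioBound_le_one_sub m c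
  have hρle : ρ ≤ 1 := by linarith [Real.exp_pos (-cum m c (m + 1))]
  filter_upwards [eventually_f_sub_le_finiteF hm hpos hδ,
    tendsto_natCast_atTop_atTop.eventually_ge_atTop (cum m c (m + 1)),
    tendsto_natCast_atTop_atTop.eventually_ge_atTop (c m / (ε * κ / 2))] with n hF hn1 hn2
  intro μ _ hatom _ τ hτ
  rcases le_total (ρ - ε) 0 with hneg | hα
  · rw [ENNReal.ofReal_of_nonpos hneg, zero_mul]; exact zero_le
  have hN : (0 : ℝ) < (n : ℝ) + 2 := by positivity
  have hIci : ∀ x, μ.real (Set.Ici x) = μ.real (Set.Ioi x) := fun x => by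
    have : NullSingletonClass μ := ⟨hatom⟩
    exact measureReal_congr Ioi_ae_eq_Ici.symm
  have hτ' : ∀ k, 1 ≤ k → k ≤ m → ((n : ℝ) + 2) * μ.real (Set.Ioi (τ k)) = c k := by
    intro k hk hkm
    have := hτ k hk hkm
    rw [Finset.sum_const, Finset.card_univ, Fintype.card_fin, nsmul_eq_mul, hIci] at this
    push_cast at this
    exact this
  -- The order of the thresholds follows from that of the `c i`, because the tail of `μ` is
  -- monotone.
  have hdecr : ∀ i k, 1 ≤ i → i < k → k ≤ m → τ k < τ i := by
    intro i k hi hik hkm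
    by_contra hle
    rw [not_lt] at hle
    have h1 : μ.real (Set.Ioi (τ k)) ≤ μ.real (Set.Ioi (τ i)) :=
      measureReal_mono (Set.Ioi_subset_Ioi hle)
    have h2 := mul_le_mul_of_nonneg_left h1 hN.le
    rw [hτ' k (by omega) hkm, hτ' i hi (by omega)] at h2
    exact absurd (lt_of_increasing hc hik hkm) (not_lt.2 h2)
  refine lintegral_prophet_le_of_tail μ (measurable_stepThreshold m τ) hα fun v _ => ?_
  obtain ⟨j, hj, hjm, hlt, hge⟩ := exists_threshold_index hdecr v
  have htail := finiteF_le_tail μ hm hpos hτ' hj hjm hlt hge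
  refine le_trans ?_ htail
  rw [instanceLaw_real_lt_prophet μ (n + 1) v]
  set q := μ.real (Set.Ioi v) with hq
  have hq0 : 0 ≤ q := measureReal_nonneg
  have hq1 : q ≤ 1 := measureReal_le_one
  set l := ((n : ℝ) + 2) * q with hl
  have hl0 : 0 ≤ l := by positivity
  have hqp : 0 ≤ (1 - q) ^ (n + 2) := pow_nonneg (by linarith) _
  have hlN : l ≤ (n : ℝ) + 2 := mul_le_of_le_one_right hN.le hq1
  have hql : q = l / ((n : ℝ) + 2) := by rw [hl]; field_simp
  change (ρ - ε) * (1 - (1 - q) ^ (n + 2)) ≤ _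
  rcases hjm.lt_or_eq with hjlt | rfl
  · have hjm' : j ≤ m := by omega
    have hlub : l ≤ c j := by
      rw [← hτ' j hj hjm']
      exact mul_le_mul_of_nonneg_left
        (measureReal_mono (Set.Ioi_subset_Ioi (hge j le_rfl hjm'))) hN.le
    have hlc : ∀ k, j ≤ k → k ≤ m → l ≤ c k := fun k hk hkm =>
      hlub.trans (le_of_increasing hc hk hkm)
    have hFj := hF j hj hjm' l hl0 hlc
    rcases hl0.lt_or_eq with hlpos | hlz
    · obtain ⟨i, rfl⟩ : ∃ i, j = i + 1 := ⟨j - 1, by omega⟩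
      have hllb : c i ≤ l := by
        rcases Nat.eq_zero_or_pos i with rfl | hi
        · rw [hc0]; exact hl0
        · rw [← hτ' i hi (by omega)]
          exact mul_le_mul_of_nonneg_left
            (measureReal_mono (Set.Ioi_subset_Ioi (hlt i hi (by omega)).le)) hN.le
      have hf := ratioBound_mul_le_f hm hc0 hc (j := i) (by omega) hlpos ⟨hllb, hlub⟩
      have hup := exp_neg_sub_pow_le (n := n) rfl hl0 hlN
      have hlow := one_sub_exp_le (n := n) rfl hlN
      rw [← hql] at hup hlow
      have hlm : l ≤ c m := hlc m (by omega) le_rfl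
      have hκl : κ * l ≤ 1 - Real.exp (-l) := by
        have h1 : Real.exp (-l) ≤ 1 / (1 + l) := by
          rw [Real.exp_neg, one_div]
          exact inv_anti₀ (by linarith) (by linarith [Real.add_one_le_exp l])
        have h2 : 1 - 1 / (1 + l) = l / (1 + l) := by field_simp; ring
        have h3 : κ * l ≤ l / (1 + l) := by
          rw [hκ, one_div_mul_eq_div]
          gcongr
        linarith
      have hsq : l ^ 2 / ((n : ℝ) + 2) ≤ ε * κ / 2 * l := by
        rw [div_le_iff₀ hN]
        have h4 := (div_le_iff₀ hδ).1 hn2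
        have h5 : l * c m ≤ l * ((n : ℝ) * (ε * κ / 2)) := mul_le_mul_of_nonneg_left h4 hl0
        have h6 : l * l ≤ l * c m := mul_le_mul_of_nonneg_left hlm hl0
        nlinarith [mul_pos hδ hlpos]
      have hρ0 : 0 ≤ ρ := by linarith
      have h7 : ρ * (1 - (1 - q) ^ (n + 2)) ≤ ρ * (1 - Real.exp (-l)) + ε * κ / 2 * l := by
        have h8 : ρ * (1 - (1 - q) ^ (n + 2) - (1 - Real.exp (-l))) ≤ ρ * (ε * κ / 2 * l) :=
          mul_le_mul_of_nonneg_left (by linarith) hρ0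
        have h9 : ρ * (ε * κ / 2 * l) ≤ ε * κ / 2 * l :=
          mul_le_of_le_one_left (by positivity) hρle
        linarith
      have h10 : ε * (κ * l) ≤ ε * (1 - (1 - q) ^ (n + 2)) :=
        mul_le_mul_of_nonneg_left (hκl.trans hlow) hε.le
      linarith
    · have hqz : q = 0 := by rw [hql, ← hlz, zero_div]
      have hfn := f_nonneg hm hj hpos hl0 hlc (cum_nonneg hpos hjm)
      rw [hqz, sub_zero, one_pow, sub_self, mul_zero]
      rw [← hlz] at hFj hfn ⊢
      linarith
  -- Here `v` lies below every threshold: any acceptance at all suffices, and the tail of the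
  -- prophet is bounded by `1`.
  · have hone := one_sub_exp_le (n := n) (N := (n : ℝ) + 2) (a := cum m c (m + 1)) rfl (by linarith)
    have hfin : finiteF m c n (m + 1) l =
        1 - (1 - cum m c (m + 1) / ((n : ℝ) + 2)) ^ (n + 2) := by
      rw [finiteF, Finset.Icc_eq_empty (by omega), Finset.sum_empty, add_zero]
    rw [hfin]
    have : (ρ - ε) * (1 - (1 - q) ^ (n + 2)) ≤ ρ - ε :=
      mul_le_of_le_one_right hα (by linarith)
    linarith

theorem exists_forall_isCompetitive {m : ℕ} (hm : 1 ≤ m) {c : ℕ → ℝ} (hc0 : c 0 = 0)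
    (hc : ∀ i < m, c i < c (i + 1)) {ε : ℝ} (hε : 0 < ε) :
    ∃ N : ℕ, ∀ n ≥ N, IsCompetitive m c n (ratioBound m c - ε) := by
  obtain ⟨N, hN⟩ := Filter.eventually_atTop.1 (eventually_isCompetitive hm hc0 hc hε)
  refine ⟨N + 2, fun n hn => ?_⟩
  obtain ⟨k, rfl⟩ := Nat.exists_eq_add_of_le hn
  have := hN (N + k) (by omega)
  rwa [show N + k + 2 = N + 2 + k by omega] at this

theorem IsCompetitive.mono {m : ℕ} {c : ℕ → ℝ} {n : ℕ} {α β : ℝ} (h : IsCompetitive m c n β)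
    (hαβ : α ≤ β) : IsCompetitive m c n α := by
  intro μ _ h1 h2 τ hτ
  refine le_trans ?_ (h μ h1 h2 τ hτ)
  gcongr

/-! ### The ten parameters -/

/-- The constant `9 / 322560` is the factor `9 / (8! * 8)` of the remainder in `Real.exp_bound`. -/
theorem exp_neg_bounds {y : ℝ} (h0 : 0 ≤ y) (h1 : y ≤ 1) :
    1 - y + y ^ 2 / 2 - y ^ 3 / 6 + y ^ 4 / 24 - y ^ 5 / 120 + y ^ 6 / 720 - y ^ 7 / 5040 -
        y ^ 8 * (9 / 322560) ≤ Real.exp (-y) ∧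
      Real.exp (-y) ≤ 1 - y + y ^ 2 / 2 - y ^ 3 / 6 + y ^ 4 / 24 - y ^ 5 / 120 + y ^ 6 / 720 -
        y ^ 7 / 5040 + y ^ 8 * (9 / 322560) := by
  have h := Real.exp_bound (x := -y) (by rwa [abs_neg, abs_of_nonneg h0]) (n := 8) (by norm_num)
  rw [abs_neg, abs_of_nonneg h0, abs_le] at h
  simp only [Finset.sum_range_succ, Finset.sum_range_zero, Nat.factorial] at h
  norm_num at h
  obtain ⟨h2, h3⟩ := h
  constructor <;> linarith

theorem exp_neg_cubic_le {h : ℝ} (hh : |h| ≤ 1) :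
    1 - h + h ^ 2 / 2 - h ^ 3 / 6 ≤ Real.exp (-h) := by
  have h1 := Real.exp_bound (x := -h) (by rwa [abs_neg]) (n := 5) (by norm_num)
  rw [abs_neg, abs_le] at h1
  simp only [Finset.sum_range_succ, Finset.sum_range_zero, Nat.factorial] at h1
  norm_num at h1
  -- The remainder of order five is `|h| ^ 5 / 100`, which the omitted term `h ^ 4 / 24` dominates.
  have h2 : |h| ^ 5 ≤ h ^ 4 := by
    have e : |h| ^ 5 = |h| * h ^ 4 := by
      rw [pow_succ, Even.pow_abs (by decide), mul_comm]
    rw [e]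
    exact mul_le_of_le_one_left (by positivity) hh
  have h3 : (0 : ℝ) ≤ h ^ 4 := by positivity
  nlinarith [h1.1]

/-- `e^{-l}` lies above a cubic polynomial around `a`, so a quadratic lower bound for the
difference decides the sign. -/
theorem quadratic_lower_bound {ρ A B D a w l M : ℝ} (hρ : 0 ≤ ρ)
    (hw0 : 0 ≤ w) (hw : w ≤ Real.exp (-a)) (hl : |l - a| ≤ 1) (hlM : l ≤ M)
    (hp2 : 0 < D + ρ * w / 2 - ρ * w * (M - a) / 6)
    (hdisc : (B + 2 * a * D - ρ * w) ^ 2 ≤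
      4 * (A + a * B + a ^ 2 * D - ρ + ρ * w) * (D + ρ * w / 2 - ρ * w * (M - a) / 6)) :
    ρ * (1 - Real.exp (-l)) ≤ A + (l * B + l ^ 2 * D) := by
  obtain ⟨h, rfl⟩ : ∃ h, l = a + h := ⟨l - a, by ring⟩
  rw [add_sub_cancel_left] at hl
  have h1 := exp_neg_cubic_le hl
  have h0 : 0 ≤ 1 - h + h ^ 2 / 2 - h ^ 3 / 6 := by
    have h2 := abs_le.1 hl
    nlinarith [mul_nonneg (sub_nonneg.2 h2.2) (sq_nonneg h)]
  have h2 : w * (1 - h + h ^ 2 / 2 - h ^ 3 / 6) ≤ Real.exp (-(a + h)) := by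
    rw [neg_add, Real.exp_add]
    exact mul_le_mul hw h1 h0 (Real.exp_pos _).le
  have h3 := mul_le_mul_of_nonneg_left h2 hρ
  -- Since `h ≤ M - a`, the cubic term is absorbed into the quadratic one.
  have h4 : ρ * w * h ^ 3 ≤ ρ * w * ((M - a) * h ^ 2) := by
    refine mul_le_mul_of_nonneg_left ?_ (mul_nonneg hρ hw0)
    nlinarith [mul_nonneg (show 0 ≤ M - a - h by linarith) (sq_nonneg h)]
  set p2 := D + ρ * w / 2 - ρ * w * (M - a) / 6 with hp2d
  set p1 := B + 2 * a * D - ρ * w with hp1d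
  set p0 := A + a * B + a ^ 2 * D - ρ + ρ * w with hp0d
  have h5 : 0 ≤ p0 + p1 * h + p2 * h ^ 2 := by
    have h6 : 0 ≤ p2 * (p0 + p1 * h + p2 * h ^ 2) := by
      -- Completing the square: `4 * p2 * (p0 + p1 * h + p2 * h ^ 2) = (2 * p2 * h + p1) ^ 2 + (4 *
      -- p0 * p2 - p1 ^ 2)`.
      nlinarith [sq_nonneg (2 * p2 * h + p1)]
    exact nonneg_of_mul_nonneg_right h6 hp2
  have h7 : p0 + p1 * h + p2 * h ^ 2 = A + ((a + h) * B + (a + h) ^ 2 * D) - ρ +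
      (ρ * (w * (1 - h + h ^ 2 / 2)) - ρ * w * ((M - a) * h ^ 2) / 6) := by
    rw [hp0d, hp1d, hp2d]; ring
  linarith

/-- The `k`-th summand of `f 10 c j l`. -/
def tenTerm (k : ℕ) (l : ℝ) : ℝ :=
  l * (2 * tenParameters k - l) / tenParameters k ^ 2 *
      (Real.exp (-cum 10 tenParameters k) - Real.exp (-cum 10 tenParameters (k + 1))) -
    l * (tenParameters k - l) / (tenParameters k * (10 : ℕ)) *
      Real.exp (-cumRest 10 tenParameters k)

theorem exp_neg_cum_succ {k : ℕ} (hk : 1 ≤ k) :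
    Real.exp (-cum 10 tenParameters (k + 1)) =
      Real.exp (-cum 10 tenParameters k) * Real.exp (-(tenParameters k / 10)) := by
  rw [cum_succ _ _ hk, ← Real.exp_add]
  congr 1
  push_cast
  ring

theorem exp_neg_cumRest {k : ℕ} (hk : k ≤ 10) :
    Real.exp (-cumRest 10 tenParameters k) =
      Real.exp (-cum 10 tenParameters k) * Real.exp (-(tenParameters k / 10)) ^ (11 - k) := by
  rw [cumRest, ← Real.exp_nat_mul, ← Real.exp_add, Nat.cast_sub (by omega)]
  congr 1
  push_cast
  ring

theorem exp_neg_cum_succ_bounds {k : ℕ} (hk : 1 ≤ k) {u v s t u' v' : ℝ}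
    (hE : u ≤ Real.exp (-cum 10 tenParameters k) ∧ Real.exp (-cum 10 tenParameters k) ≤ v)
    (hx : s ≤ Real.exp (-(tenParameters k / 10)) ∧ Real.exp (-(tenParameters k / 10)) ≤ t)
    (hs : 0 ≤ s) (hu : u' ≤ u * s) (hv : v * t ≤ v') :
    u' ≤ Real.exp (-cum 10 tenParameters (k + 1)) ∧
      Real.exp (-cum 10 tenParameters (k + 1)) ≤ v' := by
  rw [exp_neg_cum_succ hk]
  have h1 := Real.exp_pos (-cum 10 tenParameters k)
  have h2 := Real.exp_pos (-(tenParameters k / 10))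
  exact ⟨hu.trans (mul_le_mul hE.1 hx.1 hs h1.le),
    (mul_le_mul hE.2 hx.2 h2.le (h1.le.trans hE.2)).trans hv⟩

/-- On `[0, c]` the weights `l * (2 * c - l)` and `l * (c - l)` are nonnegative, so the gain may be
bounded from below through `u` and `t` and the loss from above through `v` and `t`. What remains is
a quadratic in `l` without constant term. -/
theorem tenTerm_lower_bound {k : ℕ} (hk : 1 ≤ k) (hk' : k ≤ 10) {c u v t b d l : ℝ}
    (hc : tenParameters k = c) (hc0 : 0 < c)
    (hE : u ≤ Real.exp (-cum 10 tenParameters k) ∧ Real.exp (-cum 10 tenParameters k) ≤ v)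
    (ht : Real.exp (-(tenParameters k / 10)) ≤ t) (ht1 : t ≤ 1)
    (hb : b ≤ 2 * (u * (1 - t)) / c - v * t ^ (11 - k) / 10)
    (hd : d ≤ -(u * (1 - t)) / c ^ 2 + v * t ^ (11 - k) / (10 * c))
    (hl : 0 ≤ l) (hlc : l ≤ c) : l * b + l ^ 2 * d ≤ tenTerm k l := by
  rw [tenTerm, exp_neg_cum_succ hk, exp_neg_cumRest hk', hc] at *
  set E := Real.exp (-cum 10 tenParameters k) with hEd
  set x := Real.exp (-(c / 10)) with hxd
  have hE0 : 0 < E := Real.exp_pos _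
  have hx0 : 0 < x := Real.exp_pos _
  have h1 : u * (1 - t) ≤ E - E * x := by
    rw [← mul_one_sub]
    exact mul_le_mul hE.1 (by linarith) (by linarith) hE0.le
  have h2 : E * x ^ (11 - k) ≤ v * t ^ (11 - k) :=
    mul_le_mul hE.2 (pow_le_pow_left₀ hx0.le ht _) (by positivity) (hE0.le.trans hE.2)
  have h3 : l * (2 * c - l) / c ^ 2 * (u * (1 - t)) ≤ l * (2 * c - l) / c ^ 2 * (E - E * x) :=
    mul_le_mul_of_nonneg_left h1 (div_nonneg (mul_nonneg hl (by linarith)) (by positivity))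
  have h4 : l * (c - l) / (c * (10 : ℕ)) * (E * x ^ (11 - k)) ≤
      l * (c - l) / (c * (10 : ℕ)) * (v * t ^ (11 - k)) :=
    mul_le_mul_of_nonneg_left h2 (div_nonneg (mul_nonneg hl (by linarith)) (by positivity))
  have h5 := mul_le_mul_of_nonneg_left hb hl
  have h6 := mul_le_mul_of_nonneg_left hd (sq_nonneg l)
  have h7 : l * (2 * c - l) / c ^ 2 * (u * (1 - t)) -
      l * (c - l) / (c * (10 : ℕ)) * (v * t ^ (11 - k)) =
      l * (2 * (u * (1 - t)) / c - v * t ^ (11 - k) / 10) +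
        l ^ 2 * (-(u * (1 - t)) / c ^ 2 + v * t ^ (11 - k) / (10 * c)) := by
    push_cast
    field_simp
    ring
  linarith

theorem exp_neg_tenParameters_bounds :
    (0.9650278 ≤ Real.exp (-(tenParameters 1 / 10)) ∧
      Real.exp (-(tenParameters 1 / 10)) ≤ 0.9650279) ∧
    (0.9453476 ≤ Real.exp (-(tenParameters 2 / 10)) ∧
      Real.exp (-(tenParameters 2 / 10)) ≤ 0.9453477) ∧
    (0.9172199 ≤ Real.exp (-(tenParameters 3 / 10)) ∧
      Real.exp (-(tenParameters 3 / 10)) ≤ 0.91722) ∧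
    (0.8846544 ≤ Real.exp (-(tenParameters 4 / 10)) ∧
      Real.exp (-(tenParameters 4 / 10)) ≤ 0.8846545) ∧
    (0.8475044 ≤ Real.exp (-(tenParameters 5 / 10)) ∧
      Real.exp (-(tenParameters 5 / 10)) ≤ 0.8475045) ∧
    (0.8070568 ≤ Real.exp (-(tenParameters 6 / 10)) ∧
      Real.exp (-(tenParameters 6 / 10)) ≤ 0.8070569) ∧
    (0.7720682 ≤ Real.exp (-(tenParameters 7 / 10)) ∧
      Real.exp (-(tenParameters 7 / 10)) ≤ 0.7720683) ∧
    (0.7349725 ≤ Real.exp (-(tenParameters 8 / 10)) ∧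
      Real.exp (-(tenParameters 8 / 10)) ≤ 0.7349726) ∧
    (0.6654959 ≤ Real.exp (-(tenParameters 9 / 10)) ∧
      Real.exp (-(tenParameters 9 / 10)) ≤ 0.6654961) ∧
    (0.5935472 ≤ Real.exp (-(tenParameters 10 / 10)) ∧
      Real.exp (-(tenParameters 10 / 10)) ≤ 0.5935476) := by
  refine ⟨?_, ?_, ?_, ?_, ?_, ?_, ?_, ?_, ?_, ?_⟩ <;> simp only [tenParameters]
  all_goals
    refine ⟨le_trans ?_ (exp_neg_bounds (by norm_num) (by norm_num)).1,
      (exp_neg_bounds (by norm_num) (by norm_num)).2.trans ?_⟩ <;> norm_num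

theorem exp_neg_cum_tenParameters_bounds :
    (1.0 ≤ Real.exp (-cum 10 tenParameters 1) ∧
      Real.exp (-cum 10 tenParameters 1) ≤ 1.0) ∧
    (0.9650278 ≤ Real.exp (-cum 10 tenParameters 2) ∧
      Real.exp (-cum 10 tenParameters 2) ≤ 0.9650279) ∧
    (0.9122867 ≤ Real.exp (-cum 10 tenParameters 3) ∧
      Real.exp (-cum 10 tenParameters 3) ≤ 0.912287) ∧
    (0.8367675 ≤ Real.exp (-cum 10 tenParameters 4) ∧
      Real.exp (-cum 10 tenParameters 4) ≤ 0.8367679) ∧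
    (0.74025 ≤ Real.exp (-cum 10 tenParameters 5) ∧
      Real.exp (-cum 10 tenParameters 5) ≤ 0.7402505) ∧
    (0.6273651 ≤ Real.exp (-cum 10 tenParameters 6) ∧
      Real.exp (-cum 10 tenParameters 6) ≤ 0.6273657) ∧
    (0.5063192 ≤ Real.exp (-cum 10 tenParameters 7) ∧
      Real.exp (-cum 10 tenParameters 7) ≤ 0.5063199) ∧
    (0.3909129 ≤ Real.exp (-cum 10 tenParameters 8) ∧
      Real.exp (-cum 10 tenParameters 8) ≤ 0.3909136) ∧
    (0.2873102 ≤ Real.exp (-cum 10 tenParameters 9) ∧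
      Real.exp (-cum 10 tenParameters 9) ≤ 0.2873108) ∧
    (0.1912037 ≤ Real.exp (-cum 10 tenParameters 10) ∧
      Real.exp (-cum 10 tenParameters 10) ≤ 0.1912043) ∧
    (0.1134884 ≤ Real.exp (-cum 10 tenParameters 11) ∧
      Real.exp (-cum 10 tenParameters 11) ≤ 0.1134889) := by
  obtain ⟨x1, x2, x3, x4, x5, x6, x7, x8, x9, x10⟩ := exp_neg_tenParameters_bounds
  have h1 : (1.0 : ℝ) ≤ Real.exp (-cum 10 tenParameters 1) ∧
      Real.exp (-cum 10 tenParameters 1) ≤ 1.0 := by norm_num [cum]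
  have h2 := exp_neg_cum_succ_bounds (u' := 0.9650278) (v' := 0.9650279) (by norm_num) h1 x1
    (by norm_num) (by norm_num) (by norm_num)
  have h3 := exp_neg_cum_succ_bounds (u' := 0.9122867) (v' := 0.912287) (by norm_num) h2 x2
    (by norm_num) (by norm_num) (by norm_num)
  have h4 := exp_neg_cum_succ_bounds (u' := 0.8367675) (v' := 0.8367679) (by norm_num) h3 x3
    (by norm_num) (by norm_num) (by norm_num)
  have h5 := exp_neg_cum_succ_bounds (u' := 0.74025) (v' := 0.7402505) (by norm_num) h4 x4
    (by norm_num) (by norm_num) (by norm_num)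
  have h6 := exp_neg_cum_succ_bounds (u' := 0.6273651) (v' := 0.6273657) (by norm_num) h5 x5
    (by norm_num) (by norm_num) (by norm_num)
  have h7 := exp_neg_cum_succ_bounds (u' := 0.5063192) (v' := 0.5063199) (by norm_num) h6 x6
    (by norm_num) (by norm_num) (by norm_num)
  have h8 := exp_neg_cum_succ_bounds (u' := 0.3909129) (v' := 0.3909136) (by norm_num) h7 x7
    (by norm_num) (by norm_num) (by norm_num)
  have h9 := exp_neg_cum_succ_bounds (u' := 0.2873102) (v' := 0.2873108) (by norm_num) h8 x8
    (by norm_num) (by norm_num) (by norm_num)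
  have h10 := exp_neg_cum_succ_bounds (u' := 0.1912037) (v' := 0.1912043) (by norm_num) h9 x9
    (by norm_num) (by norm_num) (by norm_num)
  have h11 := exp_neg_cum_succ_bounds (u' := 0.1134884) (v' := 0.1134889) (by norm_num) h10 x10
    (by norm_num) (by norm_num) (by norm_num)
  exact ⟨h1, h2, h3, h4, h5, h6, h7, h8, h9, h10, h11⟩

theorem sum_tenTerm_step {j : ℕ} (hj : j ≤ 10) {b d B D l : ℝ} (h : l * b + l ^ 2 * d ≤ tenTerm j l)
    (hs : l * B + l ^ 2 * D ≤ ∑ k ∈ Finset.Icc (j + 1) 10, tenTerm k l) :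
    l * (b + B) + l ^ 2 * (d + D) ≤ ∑ k ∈ Finset.Icc j 10, tenTerm k l := by
  rw [← Finset.insert_Icc_add_one_left_eq_Icc hj, Finset.sum_insert (by simp)]
  linarith

theorem tenParameters_pos (k : ℕ) (hk : 1 ≤ k) (hk' : k ≤ 10) : 0 < tenParameters k := by
  interval_cases k <;> norm_num [tenParameters]

/-- Quadratic lower bounds for the sums of `tenTerm`. -/
theorem sum_tenTerm_lower_bound {l : ℝ} (hl : 0 ≤ l) :
    (l ≤ 0.35598315 → l * (0.8834473) + l ^ 2 * (-0.2866945) ≤ ∑ k ∈ Finset.Icc 1 10, tenTerm k l) ∧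
    (l ≤ 0.56202538 → l * (0.7570141) + l ^ 2 * (-0.2074985) ≤ ∑ k ∈ Finset.Icc 2 10, tenTerm k l) ∧
    (l ≤ 0.86407969 → l * (0.6275244) + l ^ 2 * (-0.1440692) ≤ ∑ k ∈ Finset.Icc 3 10, tenTerm k l) ∧
    (l ≤ 1.22558122 → l * (0.4984282) + l ^ 2 * (-0.0958121) ≤ ∑ k ∈ Finset.Icc 4 10, tenTerm k l) ∧
    (l ≤ 1.65459166 → l * (0.3764067) + l ^ 2 * (-0.0605069) ≤ ∑ k ∈ Finset.Icc 5 10, tenTerm k l) ∧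
    (l ≤ 2.14361195 → l * (0.2673867) + l ^ 2 * (-0.0358513) ≤ ∑ k ∈ Finset.Icc 6 10, tenTerm k l) ∧
    (l ≤ 2.5868228 → l * (0.1759308) + l ^ 2 * (-0.0195294) ≤ ∑ k ∈ Finset.Icc 7 10, tenTerm k l) ∧
    (l ≤ 3.07922161 → l * (0.1046953) + l ^ 2 * (-0.0092378) ≤ ∑ k ∈ Finset.Icc 8 10, tenTerm k l) ∧
    (l ≤ 4.0722262 → l * (0.052924) + l ^ 2 * (-0.0033513) ≤ ∑ k ∈ Finset.Icc 9 10, tenTerm k l) ∧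
    (l ≤ 5.21637928 → l * (0.0184477) + l ^ 2 * (-0.0006805) ≤ ∑ k ∈ Finset.Icc 10 10, tenTerm k l) := by
  obtain ⟨x1, x2, x3, x4, x5, x6, x7, x8, x9, x10⟩ := exp_neg_tenParameters_bounds
  obtain ⟨e1, e2, e3, e4, e5, e6, e7, e8, e9, e10, -⟩ := exp_neg_cum_tenParameters_bounds
  have t1 : l ≤ 0.35598315 → l * (0.1264332) + l ^ 2 * (-0.079196) ≤ tenTerm 1 l :=
    tenTerm_lower_bound (by norm_num) (by norm_num) rfl (by norm_num) e1 x1.2 (by norm_num)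
      (by norm_num) (by norm_num) hl
  have t2 : l ≤ 0.56202538 → l * (0.1294897) + l ^ 2 * (-0.0634293) ≤ tenTerm 2 l :=
    tenTerm_lower_bound (by norm_num) (by norm_num) rfl (by norm_num) e2 x2.2 (by norm_num)
      (by norm_num) (by norm_num) hl
  have t3 : l ≤ 0.86407969 → l * (0.1290962) + l ^ 2 * (-0.0482571) ≤ tenTerm 3 l :=
    tenTerm_lower_bound (by norm_num) (by norm_num) rfl (by norm_num) e3 x3.2 (by norm_num)
      (by norm_num) (by norm_num) hl
  have t4 : l ≤ 1.22558122 → l * (0.1220215) + l ^ 2 * (-0.0353052) ≤ tenTerm 4 l :=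
    tenTerm_lower_bound (by norm_num) (by norm_num) rfl (by norm_num) e4 x4.2 (by norm_num)
      (by norm_num) (by norm_num) hl
  have t5 : l ≤ 1.65459166 → l * (0.10902) + l ^ 2 * (-0.0246556) ≤ tenTerm 5 l :=
    tenTerm_lower_bound (by norm_num) (by norm_num) rfl (by norm_num) e5 x5.2 (by norm_num)
      (by norm_num) (by norm_num) hl
  have t6 : l ≤ 2.14361195 → l * (0.0914559) + l ^ 2 * (-0.0163219) ≤ tenTerm 6 l :=
    tenTerm_lower_bound (by norm_num) (by norm_num) rfl (by norm_num) e6 x6.2 (by norm_num)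
      (by norm_num) (by norm_num) hl
  have t7 : l ≤ 2.5868228 → l * (0.0712355) + l ^ 2 * (-0.0102916) ≤ tenTerm 7 l :=
    tenTerm_lower_bound (by norm_num) (by norm_num) rfl (by norm_num) e7 x7.2 (by norm_num)
      (by norm_num) (by norm_num) hl
  have t8 : l ≤ 3.07922161 → l * (0.0517713) + l ^ 2 * (-0.0058865) ≤ tenTerm 8 l :=
    tenTerm_lower_bound (by norm_num) (by norm_num) rfl (by norm_num) e8 x8.2 (by norm_num)
      (by norm_num) (by norm_num) hl
  have t9 : l ≤ 4.0722262 → l * (0.0344763) + l ^ 2 * (-0.0026708) ≤ tenTerm 9 l :=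
    tenTerm_lower_bound (by norm_num) (by norm_num) rfl (by norm_num) e9 x9.2 (by norm_num)
      (by norm_num) (by norm_num) hl
  have t10 : l ≤ 5.21637928 → l * (0.0184477) + l ^ 2 * (-0.0006805) ≤ tenTerm 10 l :=
    tenTerm_lower_bound (by norm_num) (by norm_num) rfl (by norm_num) e10 x10.2 (by norm_num)
      (by norm_num) (by norm_num) hl
  have s10 : l ≤ 5.21637928 → l * (0.0184477) + l ^ 2 * (-0.0006805) ≤
      ∑ k ∈ Finset.Icc 10 10, tenTerm k l := by
    simpa using t10
  have s9 : l ≤ 4.0722262 → l * (0.052924) + l ^ 2 * (-0.0033513) ≤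
      ∑ k ∈ Finset.Icc 9 10, tenTerm k l := fun h => by
    convert sum_tenTerm_step (by norm_num) (t9 h) (s10 (h.trans (by norm_num))) using 3 <;> norm_num
  have s8 : l ≤ 3.07922161 → l * (0.1046953) + l ^ 2 * (-0.0092378) ≤
      ∑ k ∈ Finset.Icc 8 10, tenTerm k l := fun h => by
    convert sum_tenTerm_step (by norm_num) (t8 h) (s9 (h.trans (by norm_num))) using 3 <;> norm_num
  have s7 : l ≤ 2.5868228 → l * (0.1759308) + l ^ 2 * (-0.0195294) ≤
      ∑ k ∈ Finset.Icc 7 10, tenTerm k l := fun h => by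
    convert sum_tenTerm_step (by norm_num) (t7 h) (s8 (h.trans (by norm_num))) using 3 <;> norm_num
  have s6 : l ≤ 2.14361195 → l * (0.2673867) + l ^ 2 * (-0.0358513) ≤
      ∑ k ∈ Finset.Icc 6 10, tenTerm k l := fun h => by
    convert sum_tenTerm_step (by norm_num) (t6 h) (s7 (h.trans (by norm_num))) using 3 <;> norm_num
  have s5 : l ≤ 1.65459166 → l * (0.3764067) + l ^ 2 * (-0.0605069) ≤
      ∑ k ∈ Finset.Icc 5 10, tenTerm k l := fun h => by
    convert sum_tenTerm_step (by norm_num) (t5 h) (s6 (h.trans (by norm_num))) using 3 <;> norm_num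
  have s4 : l ≤ 1.22558122 → l * (0.4984282) + l ^ 2 * (-0.0958121) ≤
      ∑ k ∈ Finset.Icc 4 10, tenTerm k l := fun h => by
    convert sum_tenTerm_step (by norm_num) (t4 h) (s5 (h.trans (by norm_num))) using 3 <;> norm_num
  have s3 : l ≤ 0.86407969 → l * (0.6275244) + l ^ 2 * (-0.1440692) ≤
      ∑ k ∈ Finset.Icc 3 10, tenTerm k l := fun h => by
    convert sum_tenTerm_step (by norm_num) (t3 h) (s4 (h.trans (by norm_num))) using 3 <;> norm_num
  have s2 : l ≤ 0.56202538 → l * (0.7570141) + l ^ 2 * (-0.2074985) ≤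
      ∑ k ∈ Finset.Icc 2 10, tenTerm k l := fun h => by
    convert sum_tenTerm_step (by norm_num) (t2 h) (s3 (h.trans (by norm_num))) using 3 <;> norm_num
  have s1 : l ≤ 0.35598315 → l * (0.8834473) + l ^ 2 * (-0.2866945) ≤
      ∑ k ∈ Finset.Icc 1 10, tenTerm k l := fun h => by
    convert sum_tenTerm_step (by norm_num) (t1 h) (s2 (h.trans (by norm_num))) using 3 <;> norm_num
  exact ⟨s1, s2, s3, s4, s5, s6, s7, s8, s9, s10⟩

/-! ### The inequality `0.8831 * (1 - e^{-l}) ≤ f` on the ten intervals -/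

theorem f_tenParameters {j : ℕ} (hj : 1 ≤ j) (l : ℝ) :
    f 10 tenParameters j l = 1 - Real.exp (-cum 10 tenParameters j) +
      ∑ k ∈ Finset.Icc j 10, tenTerm k l :=
  f_eq (by norm_num) hj tenParameters_pos l

/-- Range reduction: the Taylor bound is valid only on `[0, 1]`, so it is applied at `a / 8` and
raised to the eighth power. -/
theorem le_exp_neg_of_eighth {a w : ℝ} (h0 : 0 ≤ a) (h1 : a ≤ 8) {s : ℝ} (hs : s =
    1 - a / 8 + (a / 8) ^ 2 / 2 - (a / 8) ^ 3 / 6 + (a / 8) ^ 4 / 24 - (a / 8) ^ 5 / 120 +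
      (a / 8) ^ 6 / 720 - (a / 8) ^ 7 / 5040 - (a / 8) ^ 8 * (9 / 322560)) (hs0 : 0 ≤ s)
    (hw : w ≤ s ^ 8) : w ≤ Real.exp (-a) := by
  have h := (exp_neg_bounds (y := a / 8) (by linarith) (by linarith)).1
  rw [← hs] at h
  have e : Real.exp (-a) = Real.exp (-(a / 8)) ^ 8 := by
    rw [← Real.exp_nat_mul]; congr 1; push_cast; ring
  rw [e]
  exact hw.trans (pow_le_pow_left₀ hs0 h 8)

/-- On the first interval both sides vanish at `l = 0`, so the comparison is made factor `l` by
factor `l` from the expansion at `0`. The tight coefficient is the linear one, `0.8834473` against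
`0.8831`. -/
theorem tenParameters_ratio_first {l : ℝ} (hl : 0 ≤ l) (hl1 : l ≤ 0.35598315) :
    0.8831 * (1 - Real.exp (-l)) ≤ f 10 tenParameters 1 l := by
  have hs := (sum_tenTerm_lower_bound hl).1 hl1
  have he := exp_neg_cubic_le (h := l) (by rw [abs_of_nonneg hl]; linarith)
  rw [f_tenParameters le_rfl]
  have h0 : Real.exp (-cum 10 tenParameters 1) = 1 := by simp [cum]
  rw [h0]
  nlinarith [mul_nonneg (mul_nonneg hl hl) (sub_nonneg.2 hl1), mul_nonneg hl hl]

theorem tenParameters_ratio_of_quadratic {j : ℕ} (hj : 1 ≤ j) {l v B D a w M : ℝ}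
    (hE : Real.exp (-cum 10 tenParameters j) ≤ v)
    (hs : l * B + l ^ 2 * D ≤ ∑ k ∈ Finset.Icc j 10, tenTerm k l)
    (hw0 : 0 ≤ w) (hw : w ≤ Real.exp (-a)) (hl : |l - a| ≤ 1) (hlM : l ≤ M)
    (hp2 : 0 < D + 0.8831 * w / 2 - 0.8831 * w * (M - a) / 6)
    (hdisc : (B + 2 * a * D - 0.8831 * w) ^ 2 ≤ 4 * (1 - v + a * B + a ^ 2 * D - 0.8831 + 0.8831 * w)
      * (D + 0.8831 * w / 2 - 0.8831 * w * (M - a) / 6)) :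
    0.8831 * (1 - Real.exp (-l)) ≤ f 10 tenParameters j l := by
  rw [f_tenParameters hj]
  have := quadratic_lower_bound (by norm_num) hw0 hw hl hlM hp2 hdisc
  linarith

theorem tenParameters_ratio {j : ℕ} (hj : j < 10) {l : ℝ} (hl0 : 0 ≤ l)
    (hl : l ∈ Set.Icc (tenParameters j) (tenParameters (j + 1))) :
    0.8831 * (1 - Real.exp (-l)) ≤ f 10 tenParameters (j + 1) l := by
  obtain ⟨-, s2, s3, s4, s5, s6, s7, s8, s9, s10⟩ := sum_tenTerm_lower_bound hl0
  obtain ⟨-, e2, e3, e4, e5, e6, e7, e8, e9, e10, -⟩ := exp_neg_cum_tenParameters_bounds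
  obtain ⟨hl1, hl2⟩ := hl
  interval_cases j <;> simp only [tenParameters] at hl1 hl2
  · exact tenParameters_ratio_first hl0 hl2
  -- In this and the following cases `a` is close to a critical point of the difference of the two
  -- sides, which keeps the linear coefficient in the discriminant small; `w` is `e^{-a}` rounded
  -- down.
  · exact tenParameters_ratio_of_quadratic (a := 0.4) (w := 0.67032) (by norm_num) e2.2 (s2 hl2)
      (by norm_num) (le_exp_neg_of_eighth (by norm_num) (by norm_num) rfl (by norm_num) (by norm_num))
      (abs_le.2 ⟨by linarith, by linarith⟩) hl2 (by norm_num) (by norm_num)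
  · exact tenParameters_ratio_of_quadratic (a := 0.795) (w := 0.451581) (by norm_num) e3.2 (s3 hl2)
      (by norm_num) (le_exp_neg_of_eighth (by norm_num) (by norm_num) rfl (by norm_num) (by norm_num))
      (abs_le.2 ⟨by linarith, by linarith⟩) hl2 (by norm_num) (by norm_num)
  · exact tenParameters_ratio_of_quadratic (a := 1.16) (w := 0.313486) (by norm_num) e4.2 (s4 hl2)
      (by norm_num) (le_exp_neg_of_eighth (by norm_num) (by norm_num) rfl (by norm_num) (by norm_num))
      (abs_le.2 ⟨by linarith, by linarith⟩) hl2 (by norm_num) (by norm_num)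
  · exact tenParameters_ratio_of_quadratic (a := 1.525) (w := 0.217621) (by norm_num) e5.2 (s5 hl2)
      (by norm_num) (le_exp_neg_of_eighth (by norm_num) (by norm_num) rfl (by norm_num) (by norm_num))
      (abs_le.2 ⟨by linarith, by linarith⟩) hl2 (by norm_num) (by norm_num)
  · exact tenParameters_ratio_of_quadratic (a := 1.91) (w := 0.14808) (by norm_num) e6.2 (s6 hl2)
      (by norm_num) (le_exp_neg_of_eighth (by norm_num) (by norm_num) rfl (by norm_num) (by norm_num))
      (abs_le.2 ⟨by linarith, by linarith⟩) hl2 (by norm_num) (by norm_num)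
  · exact tenParameters_ratio_of_quadratic (a := 2.35) (w := 0.095369) (by norm_num) e7.2 (s7 hl2)
      (by norm_num) (le_exp_neg_of_eighth (by norm_num) (by norm_num) rfl (by norm_num) (by norm_num))
      (abs_le.2 ⟨by linarith, by linarith⟩) hl2 (by norm_num) (by norm_num)
  · exact tenParameters_ratio_of_quadratic (a := 2.825) (w := 0.059308) (by norm_num) e8.2 (s8 hl2)
      (by norm_num) (le_exp_neg_of_eighth (by norm_num) (by norm_num) rfl (by norm_num) (by norm_num))
      (abs_le.2 ⟨by linarith, by linarith⟩) hl2 (by norm_num) (by norm_num)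
  · exact tenParameters_ratio_of_quadratic (a := 3.375) (w := 0.034218) (by norm_num) e9.2 (s9 hl2)
      (by norm_num) (le_exp_neg_of_eighth (by norm_num) (by norm_num) rfl (by norm_num) (by norm_num))
      (abs_le.2 ⟨by linarith, by linarith⟩) hl2 (by norm_num) (by norm_num)
  · exact tenParameters_ratio_of_quadratic (a := 4.25) (w := 0.014264) (by norm_num) e10.2 (s10 hl2)
      (by norm_num) (le_exp_neg_of_eighth (by norm_num) (by norm_num) rfl (by norm_num) (by norm_num))
      (abs_le.2 ⟨by linarith, by linarith⟩) hl2 (by norm_num) (by norm_num)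

theorem le_ratioBound_tenParameters : 0.8831 ≤ ratioBound 10 tenParameters := by
  obtain ⟨-, -, -, -, -, -, -, -, -, -, h⟩ := exp_neg_cum_tenParameters_bounds
  refine le_min ?_ (le_ciInf fun j => le_csInf ?_ ?_)
  · have e : (1 / ((10 : ℕ) : ℝ) * ∑ i ∈ Finset.Icc 1 10, tenParameters i) =
        cum 10 tenParameters 11 := rfl
    rw [e]
    linarith [h.2]
  -- `le_csInf` requires a nonempty set; the right endpoint of the interval is a positive member.
  · refine Set.Nonempty.image _ ⟨tenParameters (j + 1), ⟨?_, le_rfl⟩,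
      tenParameters_pos _ (by omega) (by omega)⟩
    obtain ⟨j, hj⟩ := j
    simp only
    interval_cases j <;> norm_num [tenParameters]
  · rintro _ ⟨l, ⟨hl, hl0⟩, rfl⟩
    have h1 : 0 < 1 - Real.exp (-l) := by
      have := Real.exp_lt_one_iff.2 (neg_neg_of_pos hl0)
      linarith
    exact (le_div_iff₀ h1).2 (tenParameters_ratio j.2 hl0.le hl)

theorem tenParameters_lt_succ : ∀ i < 10, tenParameters i < tenParameters (i + 1) := by
  intro i hi
  interval_cases i <;> norm_num [tenParameters]

end TopOneOfTwo

end

theorem mainTheorem5 :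
    (∀ (m : ℕ) (c : ℕ → ℝ), 1 ≤ m → c 0 = 0 → (∀ i < m, c i < c (i + 1)) →
      ∀ ε > (0 : ℝ), ∃ N : ℕ, ∀ n ≥ N,
        TopOneOfTwo.IsCompetitive m c n (TopOneOfTwo.ratioBound m c - ε)) ∧
    (0.883 : ℝ) ≤ TopOneOfTwo.ratioBound 10 TopOneOfTwo.tenParameters ∧
    (∃ N : ℕ, ∀ n ≥ N, TopOneOfTwo.IsCompetitive 10 TopOneOfTwo.tenParameters n 0.883) := by
  have hρ := TopOneOfTwo.le_ratioBound_tenParameters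
  refine ⟨fun m c hm hc0 hc ε hε => TopOneOfTwo.exists_forall_isCompetitive hm hc0 hc hε,
    by linarith, ?_⟩
  obtain ⟨N, hN⟩ := TopOneOfTwo.exists_forall_isCompetitive (m := 10) (by norm_num)
    (c := TopOneOfTwo.tenParameters) rfl TopOneOfTwo.tenParameters_lt_succ
    -- The gap between `0.8831` and `0.883`.
    (ε := 0.0001) (by norm_num)
  exact ⟨N, fun n hn => (hN n hn).mono (by linarith)⟩
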